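/- **Model.** In the message-passing model there are $k$ players $P_1,\dots,P_k$, and player $P_i$ holds a private input $x_i$. The players exchange point-to-point messages; a message is a nonempty bit string and is seen only by its sender and its receiver. The transcript (the sequence of all messages sent so far) specifies which player speaks next, when the protocol stops, and which player then announces the answer. The content and the receiver of a message depend only on the speaker's input, the random tapes, and the messages which the speaker has sent or received so far; likewise the announced answer depends only on what the announcing player knows. Computation is unlimited. The random tapes may even be shared among the players (private random tapes are a special case). The cost of a protocol is the maximum, over the inputs and all random tapes, of the total number of bits in the messages. For a function $f$ and a set $D$ of inputs, $R^{\delta}(f\mid D)$ is the minimum cost on $D$ of a randomized protocol which, on every input from $D$, outputs the value of $f$ except with probability at most $\delta$ over the random tapes; $R^{\delta}(f)$ is the case where $D$ consists of all inputs. **Problem.** Player $P_i$ holds a set $S_i\subseteq\{1,\dots,n\}$, and the players want to compute exactly the number of distinct elements $F_0(S_1,\dots,S_k)=\bigl|\bigcup_{i=1}^k S_i\bigr|$. **Statement.** There are absolute constants $c>0$ and $C>0$ such that for all integers $k\ge 2$ and $n$ with $C\log_2 n\le k\le n$: 1. $R^{1/3}(F_0)\ \ge\ c\,\dfrac{k\,n}{\log_2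 k}$; 2. more generally, for every integer $F$ with $2\le F\le n$, already under the promise that the number of distinct elements is of order $F$, $$R^{1/3}\bigl(F_0\ \big|\ \{(S_1,\dots,S_k): F/2\le F_0(S_1,\dots,S_k)\le F\}\bigr)\ \ge\ c\,\frac{k\,F}{\log_2 k}.$$ In short, $R^{1/3}(F_0)=\Omega(k F_0/\log k)$. -/

import Mathlib

open scoped ENNReal

namespace MessagePassing

/-- A point-to-point message: only `src` and `dst` see it. -/
structure Message (k : ℕ) where
  src : Fin k
  dst : Fin k
  body : List Bool

/-- The sequence of all messages sent so far, oldest first. -/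
abbrev Transcript (k : ℕ) := List (Message k)

namespace Transcript

variable {k : ℕ}

/-- What player `i` has seen: the messages that it sent or received, in order. -/
def view (t : Transcript k) (i : Fin k) : Transcript k :=
  t.filter fun m => decide (m.src = i ∨ m.dst = i)

/-- Total number of bits communicated. -/
def bits (t : Transcript k) : ℕ := (t.map fun m => m.body.length).sum

end Transcript

/-- A deterministic protocol in the message-passing model with `k` players, where player `i` holds
an input from `X`. The transcript specifies which player speaks next (`none` : the protocol stops)
and, at the end, which player reports the answer. The receiver and the content of a message are
chosen by the speaker, who knows nothing but its own input and the messages it sent or received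
itself. Messages are arbitrary nonempty bit strings, and computation is unlimited. -/
structure Protocol (k : ℕ) (X Out : Type) where
  speaker : Transcript k → Option (Fin k)
  reporter : Transcript k → Fin k
  receiver : Fin k → X → Transcript k → Fin k
  content : Fin k → X → Transcript k → List Bool
  content_ne_nil : ∀ i x v, content i x v ≠ []
  report : Fin k → X → Transcript k → Out

namespace Protocol

variable {k : ℕ} {X Out : Type}

/-- One round: the player whose turn it is sends one message; nothing changes after the end. -/
def step (P : Protocol k X Out) (x : Fin k → X) (t : Transcript k) : Transcript k :=
  match P.speaker t with
  | none => t
  | some i => t ++ [⟨i, P.receiver i (x i) (t.view i), P.content i (x i) (t.view i)⟩]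

/-- The transcript after `m` rounds on input `x`. -/
def run (P : Protocol k X Out) (x : Fin k → X) (m : ℕ) : Transcript k := (P.step x)^[m] []

/-- Number of bits communicated on input `x` (`⊤` if the protocol does not stop). -/
noncomputable def cost (P : Protocol k X Out) (x : Fin k → X) : ℕ∞ :=
  ⨆ m : ℕ, ((P.run x m).bits : ℕ∞)

/-- On input `x` the protocol stops and the reporting player announces `a`. -/
def Outputs (P : Protocol k X Out) (x : Fin k → X) (a : Out) : Prop :=
  ∃ m : ℕ, P.speaker (P.run x m) = none ∧
    P.report (P.reporter (P.run x m)) (x (P.reporter (P.run x m)))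
      ((P.run x m).view (P.reporter (P.run x m))) = a

end Protocol

/-- A randomized protocol: a deterministic protocol for every outcome `ω` of the random tapes.
All players may read all of `ω`, so shared randomness is allowed; private random tapes
`ω = (ω₁, …, ω_k)`, where player `i` uses `ωᵢ` only, are a special case. -/
structure RandomizedProtocol (k : ℕ) (X Out : Type) where
  Tapes : Type
  measurableSpace : MeasurableSpace Tapes
  law : @MeasureTheory.Measure Tapes measurableSpace
  isProbabilityMeasure : MeasureTheory.IsProbabilityMeasure law
  protocol : Tapes → Protocol k X Out

namespace RandomizedProtocol

variable {k : ℕ} {X Out : Type}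

/-- On every input in `D`, the protocol fails to output `f x` with probability at most `δ`. -/
def Computes (Q : RandomizedProtocol k X Out) (D : Set (Fin k → X)) (f : (Fin k → X) → Out)
    (δ : ℝ≥0∞) : Prop :=
  ∀ x ∈ D, Q.law {ω | ¬ (Q.protocol ω).Outputs x (f x)} ≤ δ

/-- The maximal number of bits communicated, over all inputs in `D` and all random tapes. -/
noncomputable def cost (Q : RandomizedProtocol k X Out) (D : Set (Fin k → X)) : ℕ∞ :=
  ⨆ x ∈ D, ⨆ ω : Q.Tapes, (Q.protocol ω).cost x

end RandomizedProtocol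

/-- The randomized `δ`-error communication complexity of `f` under the promise that the input lies
in `D`; `D = Set.univ` is the complexity of the total function `f`. -/
noncomputable def randomizedComplexity {k : ℕ} {X Out : Type} (δ : ℝ≥0∞) (D : Set (Fin k → X))
    (f : (Fin k → X) → Out) : ℕ∞ :=
  ⨅ (Q : RandomizedProtocol k X Out) (_ : Q.Computes D f δ), Q.cost D

/-- `F₀`: the number of distinct elements in the union of the sets held by the players. -/
def distinctCount {k n : ℕ} (S : Fin k → Finset (Fin n)) : ℕ := (Finset.univ.biUnion S).card

/-- The inputs with between `F / 2` and `F` distinct elements. -/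
def inputsOfOrder (k n F : ℕ) : Set (Fin k → Finset (Fin n)) :=
  {S | F ≤ 2 * distinctCount S ∧ distinctCount S ≤ F}

end MessagePassing

/-!
The lower bound is a symmetrisation argument: computing `F₀` contains one instance of two-party set
disjointness for almost every player, and each of them costs that player `Ω(F / log k)` bits.

*The hard inputs.* With `m = ⌊F / 2⌋`, a random set `y ⊆ {1, …, m}` is drawn. A special player `p₀`
holds, for every `j`, one of two elements `(j, true)`, `(j, false)`: the first if `j ∉ y`, the
second if `j ∈ y` (and one padding element if `F` is odd). Every other player holds a random set of
elements `(j, true)` with `j ∉ y`. Then `F₀ = ⌈F / 2⌉`, while a single hit (one player holds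
`(j, true)` for one `j ∈ y`) raises `F₀` by one (`distinctCount_hardInput_of_disjoint`,
`distinctCount_hardInput_of_hit`); both values satisfy the promise. So the protocol decides, for
every player `i ≠ p₀`, whether the set of player `i` is disjoint from `y`, although only the inputs
without a hit, whose law does not depend on `i`, count for the communication. On these the players
other than `p₀` together take part in messages with at most twice the total number of bits
(`Transcript.sum_bits_view_le`).

*Rectangles.* The view of player `i` is a two-party transcript between player `i` and the rest: the
inputs with a given view form a rectangle (`Protocol.run_eq_of_consistent`). There are
weights on the views, of total at most `1`, that define code lengths `-log θ`: a view of `b ≥ 1`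
bits has length `O(b log k)`, the `log k` paying for the names of sender and receiver, and the empty
view has length nearly `0` (`sum_viewWeight_le`, `neg_log_viewWeight_le`). Thus the
entropy of the view is `O(b log k)` for the expected number `b` of bits, up to a small constant.

*Two parties.* The pair (set of player `i`, `y`) has the law of `(D ∩ u, Dᶜ ∩ u)` for uniform `D`
and `u` (`expect_mask_sum_players`). Given `D` this is a vector of independent uniform bits, each
owned by one of the parties. By Gibbs' inequality (`sum_hellinger_le_entropy`) the sum over the
bits of the squared Hellinger distances between the laws of the view, with that bit set to `0` and
to `1`, is at most a constant times the entropy. So in most coordinates the view has nearly the same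
law under `(0, 0)`, `(0, 1)` and `(1, 0)`, and the rectangle property transfers this to `(1, 1)`
(`sum_sub_mul_le_of_rectangle`), which is `two_party_bound`.

*The reporting player.* A verdict announced by player `i` itself is not a function of its view and
of the inputs of the others, and the choice of the reporter is a signal that costs nothing. But only
one player reports, so this concerns a fraction `1 / (k - 1)` of the players
(`sum_reporterProb_le`), which is negligible as `k ≥ C log n` forces `k` to exceed a constant.
-/

namespace MessagePassing
open Finset Function
open scoped BigOperators

/-! ### Uniform bit strings and their parts -/

section Mask

variable {ι : Type}

/-- The coordinates of `u` on `D`, and zero elsewhere. -/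
def mask (D u : ι → Bool) : ι → Bool := fun j => D j && u j

variable [DecidableEq ι]

theorem mask_update_update (D u : ι → Bool) (j : ι) (d b : Bool) :
    mask (update D j d) (update u j b) = update (mask D u) j (d && b) := by
  funext i
  rcases eq_or_ne i j with rfl | h
  · simp [mask]
  · simp [mask, h]

theorem mask_not_update_update (D u : ι → Bool) (j : ι) (d b : Bool) :
    mask (fun i => !(update D j d) i) (update u j b) =
      update (mask (fun i => !D i) u) j (!d && b) := by
  funext i
  rcases eq_or_ne i j with rfl | h
  · simp [mask]
  · simp [mask, h]

end Mask

section Cube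

variable {ι : Type} [Fintype ι] [DecidableEq ι]

theorem expect_eq_expect_update (j : ι) (f : (ι → Bool) → ℝ) :
    𝔼 u, f u = 𝔼 u, (f (update u j false) + f (update u j true)) / 2 := by
  have hinv : Function.Involutive (fun u : ι → Bool => update u j (!u j)) := by
    intro u; simp
  have h1 : 𝔼 u, f (update u j (!u j)) = 𝔼 u, f u :=
    Fintype.expect_equiv hinv.toPerm _ _ fun _ => rfl
  have h2 : ∀ u : ι → Bool,
      f (update u j false) + f (update u j true) = f u + f (update u j (!u j)) := by
    intro u
    cases h : u j
    · rw [Bool.not_false, ← h, update_eq_self]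
    · rw [Bool.not_true, add_comm, ← h, update_eq_self]
  simp_rw [h2, ← Finset.expect_div, Finset.expect_add_distrib, h1]
  ring

/-- Resampling one coordinate of a uniform point, against a function of that coordinate. -/
theorem expect_mul_apply (j : ι) (f : (ι → Bool) → ℝ) (g : Bool → ℝ) :
    𝔼 u, f u * g (u j) =
      ((𝔼 u, f (update u j false)) * g false + (𝔼 u, f (update u j true)) * g true) / 2 := by
  rw [expect_eq_expect_update j]
  simp_rw [update_self, ← Finset.expect_div, Finset.expect_add_distrib, ← Finset.expect_mul]

theorem expect_prod_apply (q : ι → Bool → ℝ) :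
    𝔼 u : ι → Bool, ∏ j, q j (u j) = ∏ j, (q j false + q j true) / 2 := by
  have h := Finset.prod_univ_sum (fun _ : ι => (univ : Finset Bool)) q
  rw [Fintype.piFinset_univ] at h
  rw [Fintype.expect_eq_sum_div_card, ← h, Fintype.card_fun, Finset.prod_div_distrib]
  simp [add_comm]

/-- The parts of a uniform point inside and outside of `D` are independent. -/
theorem expect_mask_mul_mask (D : ι → Bool) (f g : (ι → Bool) → ℝ) :
    𝔼 u, f (mask D u) * g (mask (fun j => !D j) u) =
      (𝔼 u, f (mask D u)) * 𝔼 u, g (mask (fun j => !D j) u) := by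
  -- exchange the parts outside of `D` of two independent points
  let e : (ι → Bool) × (ι → Bool) → (ι → Bool) × (ι → Bool) := fun p =>
    (fun j => if D j then p.1 j else p.2 j, fun j => if D j then p.2 j else p.1 j)
  have he : Function.Involutive e := by
    rintro ⟨u, u'⟩
    simp only [e, Prod.mk.injEq]
    constructor <;> funext j <;> cases D j <;> simp
  have h1 : 𝔼 p : (ι → Bool) × (ι → Bool), f (mask D p.1) * g (mask (fun j => !D j) p.1) =
      𝔼 p : (ι → Bool) × (ι → Bool), f (mask D p.1) * g (mask (fun j => !D j) p.2) := by
    refine Fintype.expect_equiv he.toPerm _ _ fun p => ?_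
    have ha : mask D (e p).1 = mask D p.1 := by
      funext j; simp only [mask, e]; cases D j <;> simp
    have hb : mask (fun j => !D j) (e p).2 = mask (fun j => !D j) p.1 := by
      funext j; simp only [mask, e]; cases D j <;> simp
    simp only [Function.Involutive.coe_toPerm, ha, hb]
  have h2 : ∀ F : (ι → Bool) → (ι → Bool) → ℝ,
      𝔼 p : (ι → Bool) × (ι → Bool), F p.1 p.2 = 𝔼 u, 𝔼 u', F u u' := by
    intro F
    exact Finset.expect_product' univ univ F
  rw [h2 fun u _ => f (mask D u) * g (mask (fun j => !D j) u),
    h2 fun u u' => f (mask D u) * g (mask (fun j => !D j) u')] at h1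
  simp_rw [← Finset.mul_expect, ← Finset.expect_mul] at h1
  simpa using h1

end Cube

/-! ### Entropy and Hellinger distance -/

section Entropy

/-- The Kullback-Leibler divergence of a bit from a fair coin dominates the squared Hellinger
distance of its two (unnormalised) weights. -/
theorem half_sq_sqrt_sub_sqrt_le {a b : ℝ} (ha : 0 ≤ a) (hb : 0 ≤ b) (hab : 0 < a + b) :
    (√a - √b) ^ 2 / 2 ≤ a * Real.log (2 * (a / (a + b))) + b * Real.log (2 * (b / (a + b))) := by
  set t := √((a + b) / 2) with ht
  have ht0 : 0 < t := Real.sqrt_pos.2 (by positivity)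
  have ht2 : t ^ 2 = (a + b) / 2 := Real.sq_sqrt (by positivity)
  have key : ∀ c : ℝ, 0 ≤ c → 2 * c - 2 * √c * t ≤ c * Real.log (2 * (c / (a + b))) := by
    intro c hc
    rcases hc.eq_or_lt with rfl | hc
    · simp
    have hs : 0 < √c := Real.sqrt_pos.2 hc
    have hs2 : √c ^ 2 = c := Real.sq_sqrt hc.le
    have h1 : 2 * (c / (a + b)) = (√c / t) ^ 2 := by
      rw [div_pow, hs2, ht2]; field_simp
    have h2 := Real.one_sub_inv_le_log_of_pos (div_pos hs ht0)
    rw [h1, Real.log_pow, inv_div] at *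
    have h3 : c * (1 - t / √c) ≤ c * Real.log (√c / t) := by gcongr
    have h4 : c * (1 - t / √c) = c - √c * t := by
      rw [← hs2]; field_simp; rw [Real.sqrt_sq hs.le]; ring
    push_cast
    linarith
  have h1 := key a ha
  have h2 := key b hb
  have hA : √a ^ 2 = a := Real.sq_sqrt ha
  have hB : √b ^ 2 = b := Real.sq_sqrt hb
  have hst : √a + √b ≤ 2 * t := by
    refine (pow_le_pow_iff_left₀ (by positivity) (by positivity) two_ne_zero).1 ?_
    nlinarith [sq_nonneg (√a - √b)]
  nlinarith [mul_nonneg (sub_nonneg.2 hst) (sub_nonneg.2 hst)]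

variable {ι V : Type} [Fintype ι] [DecidableEq ι]

/-- A random variable with values in `s` that has conditional law `w · u` given a uniform bit string
`u` cannot depend much on most of the bits unless it has large entropy. The entropy
enters through the code lengths `-log θ`. This is Gibbs' inequality for the law of the pair,
compared with the weights `θ v * ∏ j, q v j (u j)`, where `q v j` is the law of bit `j` given `v`. -/
theorem sum_hellinger_le_entropy (s : Finset V) (w : V → (ι → Bool) → ℝ) (θ : V → ℝ)
    (hw0 : ∀ v u, 0 ≤ w v u) (hw1 : ∀ v u, w v u ≤ 1) (hw : ∀ u, ∑ v ∈ s, w v u = 1)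
    (hθ : ∀ v, 0 < θ v) (hθs : ∑ v ∈ s, θ v ≤ 1) :
    (∑ j, ∑ v ∈ s, (√(𝔼 u, w v (update u j false)) - √(𝔼 u, w v (update u j true))) ^ 2) / 4 ≤
      𝔼 u, ∑ v ∈ s, w v u * -Real.log (θ v) := by
  set ρ : V → ι → Bool → ℝ := fun v j b => 𝔼 u, w v (update u j b) with hρ
  have hρ0 : ∀ v j b, 0 ≤ ρ v j b := fun v j b => Finset.expect_nonneg fun u _ => hw0 _ _
  set q : V → ι → Bool → ℝ := fun v j b =>
    if ρ v j false + ρ v j true = 0 then 1 / 2 else ρ v j b / (ρ v j false + ρ v j true) with hq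
  have hq0 : ∀ v j b, 0 ≤ q v j b := by
    intro v j b
    simp only [hq]
    split_ifs
    · norm_num
    · exact div_nonneg (hρ0 _ _ _) (add_nonneg (hρ0 _ _ _) (hρ0 _ _ _))
  have hqsum : ∀ v j, q v j false + q v j true = 1 := by
    intro v j
    simp only [hq]
    split_ifs with h
    · norm_num
    · rw [← add_div, div_self h]
  have hρpos : ∀ v u j, 0 < w v u → 0 < ρ v j (u j) := by
    intro v u j h
    refine Finset.expect_pos' (fun u _ => hw0 _ _) ⟨u, mem_univ _, ?_⟩
    rwa [update_eq_self]
  have hqpos : ∀ v u j, 0 < w v u → 0 < q v j (u j) := by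
    intro v u j h
    have h1 := hρpos v u j h
    have h2 : 0 < ρ v j false + ρ v j true := by
      have h3 := hρ0 v j false
      have h4 := hρ0 v j true
      cases h5 : u j <;> rw [h5] at h1 <;> linarith
    simp only [hq, if_neg h2.ne']
    exact div_pos h1 h2
  have gibbs : ∀ v u, w v u * ∑ j, Real.log (2 * q v j (u j)) ≤
      w v u * -Real.log (θ v) + (θ v * ∏ j, (2 * q v j (u j)) - w v u) := by
    intro v u
    rcases (hw0 v u).eq_or_lt with h | h
    · rw [← h]
      have := mul_nonneg (hθ v).le
        (Finset.prod_nonneg fun j (_ : j ∈ univ) => mul_nonneg zero_le_two (hq0 v j (u j)))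
      simpa using this
    · have hp : ∀ j, 0 < 2 * q v j (u j) := fun j => mul_pos two_pos (hqpos v u j h)
      have hP : 0 < ∏ j, (2 * q v j (u j)) := Finset.prod_pos fun j _ => hp j
      have h1 := Real.log_le_sub_one_of_pos (div_pos (mul_pos (hθ v) hP) h)
      rw [Real.log_div (mul_pos (hθ v) hP).ne' h.ne', Real.log_mul (hθ v).ne' hP.ne',
        Real.log_prod fun j _ => (hp j).ne'] at h1
      have h2 : Real.log (w v u) ≤ 0 := Real.log_nonpos h.le (hw1 v u)
      have h3 := mul_le_mul_of_nonneg_left h1 h.le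
      rw [mul_sub, mul_sub, mul_add, mul_div_cancel₀ _ h.ne'] at h3
      have h4 := mul_nonpos_of_nonneg_of_nonpos h.le h2
      linarith
  have hsum : 𝔼 u, ∑ v ∈ s, w v u * ∑ j, Real.log (2 * q v j (u j)) ≤
      𝔼 u, ∑ v ∈ s, w v u * -Real.log (θ v) := by
    have h1 : 𝔼 u, ∑ v ∈ s, w v u * ∑ j, Real.log (2 * q v j (u j)) ≤
        𝔼 u, ∑ v ∈ s, (w v u * -Real.log (θ v) + (θ v * ∏ j, (2 * q v j (u j)) - w v u)) :=
      Finset.expect_le_expect fun u _ => Finset.sum_le_sum fun v _ => gibbs v u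
    simp_rw [Finset.sum_add_distrib, Finset.sum_sub_distrib, hw] at h1
    rw [Finset.expect_add_distrib, Finset.expect_sub_distrib,
      Finset.expect_sum_comm univ s
        fun (u : ι → Bool) v => θ v * ∏ j, (2 * q v j (u j))] at h1
    simp_rw [← Finset.mul_expect] at h1
    have h2 : ∀ v, 𝔼 u : ι → Bool, ∏ j, (2 * q v j (u j)) = 1 := by
      intro v
      rw [expect_prod_apply fun j b => 2 * q v j b]
      refine Finset.prod_eq_one fun j _ => ?_
      linarith [hqsum v j]
    simp_rw [h2, mul_one] at h1
    rw [Fintype.expect_const] at h1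
    linarith
  refine le_trans ?_ hsum
  have h3 : 𝔼 u, ∑ v ∈ s, w v u * ∑ j, Real.log (2 * q v j (u j)) =
      ∑ j, ∑ v ∈ s, (ρ v j false * Real.log (2 * q v j false) +
        ρ v j true * Real.log (2 * q v j true)) / 2 := by
    simp_rw [Finset.mul_sum]
    rw [Finset.expect_sum_comm, Finset.sum_comm]
    refine Finset.sum_congr rfl fun v _ => ?_
    rw [Finset.expect_sum_comm]
    exact Finset.sum_congr rfl fun j _ => expect_mul_apply j (w v) fun b => Real.log (2 * q v j b)
  rw [h3, Finset.sum_div]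
  refine Finset.sum_le_sum fun j _ => ?_
  rw [Finset.sum_div]
  refine Finset.sum_le_sum fun v _ => ?_
  rcases (add_nonneg (hρ0 v j false) (hρ0 v j true)).eq_or_lt with h | h
  · have e0 : ρ v j false = 0 := by linarith [hρ0 v j false, hρ0 v j true]
    have e1 : ρ v j true = 0 := by linarith [hρ0 v j false, hρ0 v j true]
    simp only [hρ] at e0 e1
    simp [hρ, e0, e1]
  · have := half_sq_sqrt_sub_sqrt_le (hρ0 v j false) (hρ0 v j true) h
    simp only [hq, if_neg h.ne']
    simp only [hρ] at this ⊢
    linarith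

end Entropy

/-! ### Two-party disjointness -/

section TwoParty

variable {V : Type}

/-- Cauchy-Schwarz, in a form that is linear in the squared Hellinger distance. -/
theorem sum_mul_le_hellinger (s : Finset V) {P Q r : V → ℝ} (hP : ∀ v, 0 ≤ P v)
    (hQ : ∀ v, 0 ≤ Q v) (hP1 : ∑ v ∈ s, P v = 1) (hQ1 : ∑ v ∈ s, Q v = 1)
    (hr0 : ∀ v, 0 ≤ r v) (hr1 : ∀ v, r v ≤ 1) {l : ℝ} (hl : 0 < l) :
    ∑ v ∈ s, (P v - Q v) * r v ≤ l / 2 * ∑ v ∈ s, (√(P v) - √(Q v)) ^ 2 + 2 / l := by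
  have h : ∀ v, (P v - Q v) * r v ≤ l / 2 * (√(P v) - √(Q v)) ^ 2 + (P v + Q v) / l := by
    intro v
    have h1 := Real.sq_sqrt (hP v)
    have h2 := Real.sq_sqrt (hQ v)
    set x := √(P v)
    set y := √(Q v)
    have hx : 0 ≤ x := Real.sqrt_nonneg _
    have hy : 0 ≤ y := Real.sqrt_nonneg _
    have h3 : (P v - Q v) * r v ≤ |x - y| * (x + y) := by
      have : P v - Q v = (x - y) * (x + y) := by rw [← h1, ← h2]; ring
      rw [this]
      calc (x - y) * (x + y) * r v ≤ |x - y| * (x + y) * r v := by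
            have := hr0 v
            have := le_abs_self (x - y)
            gcongr
        _ ≤ |x - y| * (x + y) * 1 := by
            have := hr1 v
            gcongr
        _ = _ := mul_one _
    have h4 : |x - y| * (x + y) ≤ l / 2 * (x - y) ^ 2 + (x + y) ^ 2 / (2 * l) := by
      have : l / 2 * (x - y) ^ 2 + (x + y) ^ 2 / (2 * l) - |x - y| * (x + y) =
          (l * |x - y| - (x + y)) ^ 2 / (2 * l) := by
        rw [← sq_abs (x - y)]; field_simp; ring
      have : 0 ≤ (l * |x - y| - (x + y)) ^ 2 / (2 * l) := by positivity
      linarith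
    have h5 : (x + y) ^ 2 / (2 * l) ≤ (P v + Q v) / l := by
      rw [div_le_div_iff₀ (by positivity) hl, ← h1, ← h2]
      nlinarith [mul_nonneg hl.le (sq_nonneg (x - y))]
    linarith
  refine (Finset.sum_le_sum fun v _ => h v).trans (le_of_eq ?_)
  rw [Finset.sum_add_distrib, ← Finset.mul_sum, ← Finset.sum_div, Finset.sum_add_distrib, hP1, hQ1]
  norm_num

/-- Cut and paste: the four products `P a b = f a * g b` satisfy
`h(P 0 0, P 1 1) = h(P 0 1, P 1 0)` for the Hellinger distance `h`, so that `P 0 1` and `P 1 1` are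
close when `P 0 0` is close to `P 0 1` and to `P 1 0`. -/
theorem sum_sub_mul_le_of_rectangle (s : Finset V) {f g : Bool → V → ℝ} {r : V → ℝ}
    (hf : ∀ a v, 0 ≤ f a v) (hg : ∀ b v, 0 ≤ g b v) (h1 : ∀ a b, ∑ v ∈ s, f a v * g b v = 1)
    (hr0 : ∀ v, 0 ≤ r v) (hr1 : ∀ v, r v ≤ g true v) {l : ℝ} (hl : 0 < l) :
    ∑ v ∈ s, (f false v - f true v) * r v ≤
      3 * l * (∑ v ∈ s, (√(f false v * g false v) - √(f true v * g false v)) ^ 2 +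
        ∑ v ∈ s, (√(f false v * g false v) - √(f false v * g true v)) ^ 2) + 2 / l := by
  have hP : ∀ a b v, 0 ≤ f a v * g b v := fun a b v => mul_nonneg (hf a v) (hg b v)
  have hstep := sum_mul_le_hellinger s (hP false true) (hP true true) (h1 _ _) (h1 _ _)
    (r := fun v => r v / g true v) (fun v => div_nonneg (hr0 v) (hg _ v))
    (fun v => div_le_one_of_le₀ (hr1 v) (hg _ v)) hl
  have hL : ∀ v, (f false v * g true v - f true v * g true v) * (r v / g true v) =
      (f false v - f true v) * r v := by
    intro v
    rcases (hg true v).eq_or_lt with h | h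
    · have : r v = 0 := le_antisymm (h ▸ hr1 v) (hr0 v)
      simp [this]
    · field_simp
  simp_rw [hL] at hstep
  refine hstep.trans ?_
  have hsq : ∀ a b v, √(f a v * g b v) ^ 2 = f a v * g b v := fun a b v => Real.sq_sqrt (hP a b v)
  have hexp : ∀ a b a' b', ∑ v ∈ s, (√(f a v * g b v) - √(f a' v * g b' v)) ^ 2 =
      2 - 2 * ∑ v ∈ s, √(f a v * g b v) * √(f a' v * g b' v) := by
    intro a b a' b'
    simp_rw [sub_sq, hsq, Finset.sum_add_distrib, Finset.sum_sub_distrib, h1, mul_assoc,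
      ← Finset.mul_sum]
    ring
  have hcut : ∑ v ∈ s, (√(f false v * g false v) - √(f true v * g true v)) ^ 2 =
      ∑ v ∈ s, (√(f false v * g true v) - √(f true v * g false v)) ^ 2 := by
    rw [hexp, hexp]
    congr 2
    refine Finset.sum_congr rfl fun v _ => ?_
    rw [← Real.sqrt_mul (hP _ _ _), ← Real.sqrt_mul (hP _ _ _)]
    congr 1
    ring
  have ha : ∑ v ∈ s, (√(f false v * g true v) - √(f true v * g true v)) ^ 2 ≤
      2 * ∑ v ∈ s, (√(f false v * g false v) - √(f false v * g true v)) ^ 2 +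
        2 * ∑ v ∈ s, (√(f false v * g false v) - √(f true v * g true v)) ^ 2 := by
    rw [Finset.mul_sum, Finset.mul_sum, ← Finset.sum_add_distrib]
    refine Finset.sum_le_sum fun v _ => ?_
    nlinarith [sq_nonneg ((√(f false v * g false v) - √(f false v * g true v)) +
      (√(f false v * g false v) - √(f true v * g true v)))]
  have hb : ∑ v ∈ s, (√(f false v * g true v) - √(f true v * g false v)) ^ 2 ≤
      2 * ∑ v ∈ s, (√(f false v * g false v) - √(f false v * g true v)) ^ 2 +
        2 * ∑ v ∈ s, (√(f false v * g false v) - √(f true v * g false v)) ^ 2 := by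
    rw [Finset.mul_sum, Finset.mul_sum, ← Finset.sum_add_distrib]
    refine Finset.sum_le_sum fun v _ => ?_
    nlinarith [sq_nonneg ((√(f false v * g false v) - √(f false v * g true v)) +
      (√(f false v * g false v) - √(f true v * g false v)))]
  have hc : 0 ≤ ∑ v ∈ s, (√(f false v * g false v) - √(f true v * g false v)) ^ 2 :=
    Finset.sum_nonneg fun v _ => sq_nonneg _
  rw [hcut] at ha
  have : ∑ v ∈ s, (√(f false v * g true v) - √(f true v * g true v)) ^ 2 ≤
      6 * (∑ v ∈ s, (√(f false v * g false v) - √(f true v * g false v)) ^ 2 +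
        ∑ v ∈ s, (√(f false v * g false v) - √(f false v * g true v)) ^ 2) := by linarith
  have := mul_le_mul_of_nonneg_left this (half_pos hl).le
  linarith

variable {ι : Type} [Fintype ι] [DecidableEq ι]

/-- Two-party set disjointness on inputs of the form `(mask D u, mask Dᶜ u)`, with `D` and `u`
uniform. A family of rectangles `α v × β v` that partitions the inputs and
has small entropy cannot tell the disjoint pairs which have `(0, 1)` in
coordinate `j` from the pairs which have `(1, 1)` there. -/
theorem two_party_bound (s : Finset V) (α β r : V → (ι → Bool) → ℝ) (θ : V → ℝ)
    (hα0 : ∀ v x, 0 ≤ α v x) (hα1 : ∀ v x, α v x ≤ 1) (hβ0 : ∀ v y, 0 ≤ β v y)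
    (hβ1 : ∀ v y, β v y ≤ 1) (hαβ : ∀ x y, ∑ v ∈ s, α v x * β v y = 1)
    (hr0 : ∀ v y, 0 ≤ r v y) (hrβ : ∀ v y, r v y ≤ β v y)
    (hθ : ∀ v, 0 < θ v) (hθs : ∑ v ∈ s, θ v ≤ 1) {l : ℝ} (hl : 0 < l) :
    ∑ j, 𝔼 D : ι → Bool, 𝔼 u : ι → Bool, ∑ v ∈ s,
        (α v (update (mask D u) j false) - α v (update (mask D u) j true)) *
          r v (update (mask (fun i => !D i) u) j true) ≤
      24 * l * (𝔼 D : ι → Bool, 𝔼 u : ι → Bool, ∑ v ∈ s,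
        α v (mask D u) * β v (mask (fun i => !D i) u) * -Real.log (θ v)) +
      2 * Fintype.card ι / l := by
  -- the acceptance weights of the first party, given bit `a` in coordinate `j`, and of the second
  set f : (ι → Bool) → ι → Bool → V → ℝ := fun D j a v => 𝔼 u, α v (update (mask D u) j a) with hf
  set g : (ι → Bool) → ι → Bool → V → ℝ :=
    fun D j b v => 𝔼 u, β v (update (mask (fun i => !D i) u) j b) with hg
  set r' : (ι → Bool) → ι → V → ℝ :=
    fun D j v => 𝔼 u, r v (update (mask (fun i => !D i) u) j true) with hr'
  set H₁ : (ι → Bool) → ι → ℝ := fun D j => ∑ v ∈ s,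
    (√(f D j false v * g D j false v) - √(f D j true v * g D j false v)) ^ 2 with hH₁
  set H₂ : (ι → Bool) → ι → ℝ := fun D j => ∑ v ∈ s,
    (√(f D j false v * g D j false v) - √(f D j false v * g D j true v)) ^ 2 with hH₂
  have indep : ∀ (D : ι → Bool) (j : ι) (a b : Bool) (p q : (ι → Bool) → ℝ),
      𝔼 u, p (update (mask D u) j a) * q (update (mask (fun i => !D i) u) j b) =
        (𝔼 u, p (update (mask D u) j a)) * 𝔼 u, q (update (mask (fun i => !D i) u) j b) :=
    fun D j a b p q =>
      expect_mask_mul_mask D (fun x => p (update x j a)) (fun y => q (update y j b))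
  have hfg1 : ∀ D j a b, ∑ v ∈ s, f D j a v * g D j b v = 1 := by
    intro D j a b
    simp only [hf, hg, ← indep]
    rw [← Finset.expect_sum_comm]
    simp [hαβ]
  have hlocal : ∀ D j, 𝔼 u : ι → Bool, ∑ v ∈ s,
        (α v (update (mask D u) j false) - α v (update (mask D u) j true)) *
          r v (update (mask (fun i => !D i) u) j true) ≤
      3 * l * (H₁ D j + H₂ D j) + 2 / l := by
    intro D j
    have h := sum_sub_mul_le_of_rectangle s (f := f D j) (g := g D j) (r := r' D j)
      (fun a v => Finset.expect_nonneg fun u _ => hα0 _ _)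
      (fun a v => Finset.expect_nonneg fun u _ => hβ0 _ _) (hfg1 D j)
      (fun v => Finset.expect_nonneg fun u _ => hr0 _ _)
      (fun v => Finset.expect_le_expect fun u _ => hrβ _ _) hl
    refine le_trans (le_of_eq ?_) h
    rw [Finset.expect_sum_comm]
    refine Finset.sum_congr rfl fun v _ => ?_
    simp only [hf, hr', sub_mul, Finset.expect_sub_distrib, ← indep]
  have hent : ∀ D, (∑ j, ∑ v ∈ s,
      (√(f D j false v * g D j false v) - √(f D j (D j) v * g D j (!D j) v)) ^ 2) / 4 ≤
      𝔼 u : ι → Bool, ∑ v ∈ s,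
        α v (mask D u) * β v (mask (fun i => !D i) u) * -Real.log (θ v) := by
    intro D
    have h := sum_hellinger_le_entropy s
      (fun v u => α v (mask D u) * β v (mask (fun i => !D i) u)) θ
      (fun v u => mul_nonneg (hα0 _ _) (hβ0 _ _))
      (fun v u => mul_le_one₀ (hα1 _ _) (hβ0 _ _) (hβ1 _ _)) (fun u => hαβ _ _) hθ hθs
    have hup : ∀ v j b, 𝔼 u, α v (mask D (update u j b)) *
        β v (mask (fun i => !D i) (update u j b)) = f D j (D j && b) v * g D j (!D j && b) v := by
      intro v j b
      simp only [hf, hg]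
      rw [← indep]
      refine Finset.expect_congr rfl fun u _ => ?_
      have e1 := mask_update_update D u j (D j) b
      have e2 := mask_not_update_update D u j (D j) b
      rw [update_eq_self] at e1 e2
      rw [e1, e2]
    simp only [hup, Bool.and_false, Bool.and_true] at h
    exact h
  have hfD : ∀ D j d a v, f (update D j d) j a v = f D j a v := by
    intro D j d a v
    refine Finset.expect_congr rfl fun u _ => ?_
    have e := mask_update_update D u j d (u j)
    rw [update_eq_self] at e
    rw [e, update_idem]
  have hgD : ∀ D j d b v, g (update D j d) j b v = g D j b v := by
    intro D j d b v
    refine Finset.expect_congr rfl fun u _ => ?_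
    have e := mask_not_update_update D u j d (u j)
    rw [update_eq_self] at e
    rw [e, update_idem]
  have hres : ∀ j, 𝔼 D, ∑ v ∈ s,
      (√(f D j false v * g D j false v) - √(f D j (D j) v * g D j (!D j) v)) ^ 2 =
      𝔼 D, (H₁ D j + H₂ D j) / 2 := by
    intro j
    rw [expect_eq_expect_update j]
    refine Finset.expect_congr rfl fun D _ => ?_
    simp only [hfD, hgD, update_self, hH₁, hH₂, Bool.not_false, Bool.not_true]
    ring
  have hent' : (∑ j, 𝔼 D, (H₁ D j + H₂ D j) / 2) / 4 ≤
      𝔼 D : ι → Bool, 𝔼 u : ι → Bool, ∑ v ∈ s,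
        α v (mask D u) * β v (mask (fun i => !D i) u) * -Real.log (θ v) := by
    simp_rw [← hres]
    rw [← Finset.expect_sum_comm, Finset.expect_div]
    exact Finset.expect_le_expect fun D _ => hent D
  have hsum : ∑ j, 𝔼 D : ι → Bool, 𝔼 u : ι → Bool, ∑ v ∈ s,
        (α v (update (mask D u) j false) - α v (update (mask D u) j true)) *
          r v (update (mask (fun i => !D i) u) j true) ≤
      ∑ j, (6 * l * (𝔼 D, (H₁ D j + H₂ D j) / 2) + 2 / l) := by
    refine Finset.sum_le_sum fun j _ => ?_
    refine (Finset.expect_le_expect fun D _ => hlocal D j).trans (le_of_eq ?_)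
    rw [Finset.expect_add_distrib, ← Finset.mul_expect, Fintype.expect_const,
      ← Finset.expect_div univ (fun D => H₁ D j + H₂ D j) 2]
    ring
  refine hsum.trans ?_
  rw [Finset.sum_add_distrib, ← Finset.mul_sum, Finset.sum_const, Finset.card_univ, nsmul_eq_mul]
  have := mul_le_mul_of_nonneg_left hent' hl.le
  have e : (Fintype.card ι : ℝ) * (2 / l) = 2 * Fintype.card ι / l := by ring
  linarith

end TwoParty

/-! ### Code lengths of views -/

section Kraft

/-- If all letters together have weight at most `1 / 2`, then all words together have weight at most
`1 + 1 / 2 + 1 / 4 + ⋯ = 2`. -/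
theorem sum_list_prod_le_two {α : Type} (τ : α → ℝ) (h0 : ∀ a, 0 ≤ τ a)
    (h1 : ∀ A : Finset α, ∑ a ∈ A, τ a ≤ 1 / 2) (S : Finset (List α)) :
    ∑ l ∈ S, (l.map τ).prod ≤ 2 := by
  classical
  have hnn : ∀ l : List α, 0 ≤ (l.map τ).prod := by
    intro l
    refine List.prod_nonneg fun a ha => ?_
    obtain ⟨b, -, rfl⟩ := List.mem_map.1 ha
    exact h0 b
  have key : ∀ (n : ℕ) (S : Finset (List α)), (∀ l ∈ S, l.length ≤ n) →
      ∑ l ∈ S, (l.map τ).prod ≤ 2 := by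
    intro n
    induction n with
    | zero =>
      intro S hS
      have hsub : S ⊆ {[]} := fun l hl => by
        simpa using List.length_eq_zero_iff.1 (Nat.le_zero.1 (hS l hl))
      have := Finset.sum_le_sum_of_subset_of_nonneg (f := fun l : List α => (l.map τ).prod) hsub
        fun l _ _ => hnn l
      refine this.trans ?_
      simp
    | succ n ih =>
      intro S hS
      -- the nonempty lists of `S` are of the form `a :: l`, with `l` of length at most `n`
      let A : Finset α := S.biUnion fun l => l.toFinset
      let B : Finset (List α) := S.image List.tail
      have hsub : S ⊆ insert [] ((A ×ˢ B).image fun p => p.1 :: p.2) := by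
        intro l hl
        cases l with
        | nil => simp
        | cons a l =>
          refine mem_insert_of_mem (mem_image.2 ⟨(a, l), mem_product.2 ⟨?_, ?_⟩, rfl⟩)
          · exact mem_biUnion.2 ⟨_, hl, by simp⟩
          · exact mem_image.2 ⟨_, hl, rfl⟩
      have hB : ∑ l ∈ B, (l.map τ).prod ≤ 2 := by
        refine ih B fun l hl => ?_
        obtain ⟨l', hl', rfl⟩ := mem_image.1 hl
        have := hS l' hl'
        rw [List.length_tail]
        omega
      have hinj : Set.InjOn (fun p : α × List α => p.1 :: p.2) (A ×ˢ B : Finset _) := by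
        rintro ⟨a, l⟩ - ⟨a', l'⟩ - h
        simpa using h
      calc ∑ l ∈ S, (l.map τ).prod
          ≤ ∑ l ∈ insert [] ((A ×ˢ B).image fun p => p.1 :: p.2), (l.map τ).prod :=
            Finset.sum_le_sum_of_subset_of_nonneg hsub fun l _ _ => hnn l
        _ = 1 + (∑ a ∈ A, τ a) * ∑ l ∈ B, (l.map τ).prod := by
            rw [Finset.sum_insert (by simp), Finset.sum_image hinj, Finset.sum_mul_sum,
              Finset.sum_product]
            simp
        _ ≤ 1 + 1 / 2 * 2 := by
            have := h1 A
            have : 0 ≤ ∑ l ∈ B, (l.map τ).prod := Finset.sum_nonneg fun l _ => hnn l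
            gcongr
        _ = 2 := by norm_num
  exact key (S.sup List.length) S fun l hl => Finset.le_sup (f := List.length) hl

/-- The weight `4^{-|body|} / (4 k²)`: all messages together have weight at most `1 / 2`. -/
noncomputable def messageWeight {k : ℕ} (μ : Message k) : ℝ :=
  (μ.body.map fun _ => (1 / 4 : ℝ)).prod / (4 * k ^ 2)

variable {k : ℕ}

theorem messageWeight_eq (μ : Message k) :
    messageWeight μ = (1 / 4) ^ μ.body.length / (4 * k ^ 2) := by
  simp [messageWeight]

theorem messageWeight_pos (hk : 0 < k) (μ : Message k) : 0 < messageWeight μ := by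
  rw [messageWeight_eq]
  positivity

theorem sum_messageWeight_le (hk : 0 < k) (A : Finset (Message k)) :
    ∑ μ ∈ A, messageWeight μ ≤ 1 / 2 := by
  classical
  let B : Finset (List Bool) := A.image Message.body
  let e : Message k → Fin k × Fin k × List Bool := fun μ => (μ.src, μ.dst, μ.body)
  have he : Set.InjOn e A := by
    rintro ⟨a, b, c⟩ - ⟨a', b', c'⟩ - h
    simpa [e] using h
  have hB : ∑ l ∈ B, (l.map fun _ => (1 / 4 : ℝ)).prod ≤ 2 := by
    refine sum_list_prod_le_two (fun _ : Bool => (1 / 4 : ℝ)) (fun _ => by norm_num) (fun A => ?_) B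
    have : (A.card : ℝ) ≤ 2 := by exact_mod_cast A.card_le_univ
    rw [Finset.sum_const, nsmul_eq_mul]
    linarith
  have hk' : (0 : ℝ) < k := by exact_mod_cast hk
  calc ∑ μ ∈ A, messageWeight μ
      = ∑ p ∈ A.image e, (p.2.2.map fun _ => (1 / 4 : ℝ)).prod / (4 * (k : ℝ) ^ 2) := by
        rw [Finset.sum_image he]
        rfl
    _ ≤ ∑ p ∈ univ ×ˢ univ ×ˢ B, (p.2.2.map fun _ => (1 / 4 : ℝ)).prod / (4 * (k : ℝ) ^ 2) := by
        refine Finset.sum_le_sum_of_subset_of_nonneg ?_ fun p _ _ => ?_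
        · intro p hp
          obtain ⟨μ, hμ, rfl⟩ := mem_image.1 hp
          simp only [mem_product, mem_univ, true_and, e]
          exact mem_image_of_mem _ hμ
        · simp only [List.map_const', List.prod_replicate]
          positivity
    _ = k * (k * ((∑ l ∈ B, (l.map fun _ => (1 / 4 : ℝ)).prod) / (4 * (k : ℝ) ^ 2))) := by
        rw [Finset.sum_product]
        simp_rw [Finset.sum_product, ← Finset.sum_div]
        rw [Finset.sum_const, Finset.sum_const, Finset.card_univ, Fintype.card_fin, nsmul_eq_mul,
          nsmul_eq_mul]
        ring
    _ ≤ k * (k * (2 / (4 * (k : ℝ) ^ 2))) := by gcongr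
    _ = 1 / 2 := by field_simp; norm_num

/-- A sub-probability on the sequences of messages, giving nearly all the weight to the empty
sequence: only a party that takes part in the conversation has a long code word. -/
noncomputable def viewWeight (η : ℝ) (t : Transcript k) : ℝ :=
  if t = [] then 1 - η else η / 2 * (t.map messageWeight).prod

theorem viewWeight_pos (hk : 0 < k) {η : ℝ} (h0 : 0 < η) (h1 : η < 1) (t : Transcript k) :
    0 < viewWeight η t := by
  unfold viewWeight
  split_ifs
  · linarith
  · refine mul_pos (half_pos h0) (List.prod_pos fun a ha => ?_)
    obtain ⟨μ, -, rfl⟩ := List.mem_map.1 ha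
    exact messageWeight_pos hk μ

theorem sum_viewWeight_le (hk : 0 < k) {η : ℝ} (h0 : 0 < η) (h1 : η < 1)
    (S : Finset (Transcript k)) : ∑ t ∈ S, viewWeight η t ≤ 1 := by
  classical
  have hnn : ∀ t : Transcript k, 0 ≤ (t.map messageWeight).prod := by
    intro t
    refine List.prod_nonneg fun a ha => ?_
    obtain ⟨b, -, rfl⟩ := List.mem_map.1 ha
    exact (messageWeight_pos hk b).le
  have h2 := sum_list_prod_le_two messageWeight (fun μ => (messageWeight_pos hk μ).le)
    (sum_messageWeight_le hk) (S.filter fun t => t ≠ [])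
  rw [← Finset.sum_filter_add_sum_filter_not S (fun t => t = [])]
  have ha : ∑ t ∈ S.filter (fun t => t = []), viewWeight η t ≤ 1 - η := by
    calc ∑ t ∈ S.filter (fun t => t = []), viewWeight η t
        ≤ ∑ t ∈ ({[]} : Finset (Transcript k)), viewWeight η t := by
          refine Finset.sum_le_sum_of_subset_of_nonneg ?_ fun t _ _ => (viewWeight_pos hk h0 h1 t).le
          intro t ht
          simpa using (mem_filter.1 ht).2
      _ = 1 - η := by simp [viewWeight]
  have hb : ∑ t ∈ S.filter (fun t => ¬ t = []), viewWeight η t =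
      η / 2 * ∑ t ∈ S.filter (fun t => t ≠ []), (t.map messageWeight).prod := by
    rw [Finset.mul_sum]
    refine Finset.sum_congr rfl fun t ht => ?_
    rw [viewWeight, if_neg (mem_filter.1 ht).2]
  rw [hb]
  have := mul_le_mul_of_nonneg_left h2 (half_pos h0).le
  linarith

theorem neg_log_prod_messageWeight_le (hk : 0 < k) (t : Transcript k)
    (ht : ∀ μ ∈ t, μ.body ≠ []) :
    -Real.log ((t.map messageWeight).prod) ≤
      t.bits * (2 * Real.log 4 + 2 * Real.log k) := by
  have hk' : (0 : ℝ) < k := by exact_mod_cast hk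
  have hlk : 0 ≤ Real.log k := Real.log_nonneg (by exact_mod_cast hk)
  have hl4 : 0 ≤ Real.log 4 := Real.log_nonneg (by norm_num)
  induction t with
  | nil => simp [Transcript.bits]
  | cons μ t ih =>
    have h1 := ih fun μ hμ => ht μ (List.mem_cons_of_mem _ hμ)
    have hlen : (1 : ℝ) ≤ μ.body.length := by
      exact_mod_cast List.length_pos_iff.2 (ht μ List.mem_cons_self)
    have hpos : 0 < (t.map messageWeight).prod := by
      refine List.prod_pos fun a ha => ?_
      obtain ⟨ν, -, rfl⟩ := List.mem_map.1 ha
      exact messageWeight_pos hk ν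
    have h2 : -Real.log (messageWeight μ) =
        μ.body.length * Real.log 4 + Real.log 4 + 2 * Real.log k := by
      rw [messageWeight_eq, Real.log_div (by positivity) (by positivity),
        Real.log_mul (by norm_num) (by positivity), Real.log_pow, Real.log_pow, one_div,
        Real.log_inv]
      push_cast
      ring
    have h3 : (Transcript.bits (μ :: t) : ℝ) = μ.body.length + Transcript.bits t := by
      simp [Transcript.bits]
    rw [List.map_cons, List.prod_cons, Real.log_mul (messageWeight_pos hk μ).ne' hpos.ne', h3]
    nlinarith

theorem neg_log_viewWeight_le (hk : 0 < k) {η : ℝ} (h0 : 0 < η) (h1 : η < 1) (t : Transcript k)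
    (ht : ∀ μ ∈ t, μ.body ≠ []) :
    -Real.log (viewWeight η t) ≤ -Real.log (1 - η) +
      t.bits * (-Real.log (η / 2) + 2 * Real.log 4 + 2 * Real.log k) := by
  have hη : 0 ≤ -Real.log (1 - η) := by
    have := Real.log_nonpos (x := 1 - η) (by linarith) (by linarith)
    linarith
  have hη2 : 0 ≤ -Real.log (η / 2) := by
    have := Real.log_nonpos (x := η / 2) (by linarith) (by linarith)
    linarith
  unfold viewWeight
  split_ifs with h
  · simp [h, Transcript.bits]
  · have hpos : 0 < (t.map messageWeight).prod := by
      refine List.prod_pos fun a ha => ?_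
      obtain ⟨ν, -, rfl⟩ := List.mem_map.1 ha
      exact messageWeight_pos hk ν
    have h2 := neg_log_prod_messageWeight_le hk t ht
    have hbits : (1 : ℝ) ≤ t.bits := by
      cases t with
      | nil => exact absurd rfl h
      | cons μ t =>
        have : 0 < μ.body.length := List.length_pos_iff.2 (ht μ List.mem_cons_self)
        have : 1 ≤ Transcript.bits (μ :: t) := by
          simp only [Transcript.bits, List.map_cons, List.sum_cons]
          omega
        exact_mod_cast this
    rw [Real.log_mul (by positivity) hpos.ne']
    nlinarith

end Kraft

/-! ### Runs of deterministic protocols -/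

section Protocols

variable {k : ℕ} {X Out : Type}

namespace Transcript

theorem view_append (t t' : Transcript k) (i : Fin k) :
    view (t ++ t') i = view t i ++ view t' i := List.filter_append ..

theorem bits_append (t t' : Transcript k) : bits (t ++ t') = bits t + bits t' := by
  simp [bits]

theorem sum_bits_view_le (t : Transcript k) : ∑ i, (t.view i).bits ≤ 2 * t.bits := by
  induction t with
  | nil => simp [view, bits]
  | cons μ t ih =>
    have h : ∀ i, bits (view (μ :: t) i) ≤
        ((if μ.src = i then μ.body.length else 0) + if μ.dst = i then μ.body.length else 0) +
          bits (view t i) := by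
      intro i
      by_cases h1 : μ.src = i <;> by_cases h2 : μ.dst = i <;> simp [view, bits, h1, h2]
    refine (Finset.sum_le_sum fun i _ => h i).trans ?_
    rw [Finset.sum_add_distrib, Finset.sum_add_distrib, Finset.sum_ite_eq, Finset.sum_ite_eq]
    have : bits (μ :: t) = μ.body.length + bits t := by simp [bits]
    simp only [mem_univ, if_true]
    omega

end Transcript

namespace Protocol

variable (P : Protocol k X Out)

theorem run_succ (x : Fin k → X) (m : ℕ) : P.run x (m + 1) = P.step x (P.run x m) :=
  Function.iterate_succ_apply' ..

theorem step_of_none {x : Fin k → X} {t : Transcript k} (h : P.speaker t = none) :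
    P.step x t = t := by
  simp [step, h]

theorem step_of_some {x : Fin k → X} {t : Transcript k} {i : Fin k} (h : P.speaker t = some i) :
    P.step x t = t ++ [⟨i, P.receiver i (x i) (t.view i), P.content i (x i) (t.view i)⟩] := by
  simp [step, h]

theorem body_ne_nil_of_mem_run (x : Fin k → X) (m : ℕ) : ∀ μ ∈ P.run x m, μ.body ≠ [] := by
  induction m with
  | zero => simp [run]
  | succ m ih =>
    rw [run_succ]
    cases h : P.speaker (P.run x m) with
    | none => rwa [P.step_of_none h]
    | some i =>
      rw [P.step_of_some h]
      intro μ hμ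
      rcases List.mem_append.1 hμ with hμ | hμ
      · exact ih μ hμ
      · rw [List.mem_singleton.1 hμ]
        exact P.content_ne_nil _ _ _

theorem run_add_of_none {x : Fin k → X} {m : ℕ} (h : P.speaker (P.run x m) = none) (d : ℕ) :
    P.run x (m + d) = P.run x m := by
  induction d with
  | zero => rfl
  | succ d ih => rw [← add_assoc, run_succ, ih, P.step_of_none h]

/-- As messages are nonempty, a protocol that is still running after `m` rounds is expensive. -/
theorem lt_bits_run_succ {x : Fin k → X} {m : ℕ} (h : P.speaker (P.run x m) ≠ none) :
    m < (P.run x (m + 1)).bits := by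
  induction m with
  | zero =>
    obtain ⟨i, hi⟩ := Option.ne_none_iff_exists'.1 h
    rw [run_succ, P.step_of_some hi, Transcript.bits_append]
    have := List.length_pos_iff.2
      (P.content_ne_nil i (x i) ((P.run x 0).view i))
    simp only [Transcript.bits, List.map_cons, List.map_nil, List.sum_cons, List.sum_nil]
    omega
  | succ m ih =>
    have h1 : P.speaker (P.run x m) ≠ none := fun h0 => h (by
      rw [P.run_add_of_none h0 1, h0])
    have h2 := ih h1
    obtain ⟨i, hi⟩ := Option.ne_none_iff_exists'.1 h
    rw [run_succ, P.step_of_some hi, Transcript.bits_append]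
    have := List.length_pos_iff.2
      (P.content_ne_nil i (x i) ((P.run x (m + 1)).view i))
    have h3 : Transcript.bits [(⟨i, P.receiver i (x i) ((P.run x (m + 1)).view i),
        P.content i (x i) ((P.run x (m + 1)).view i)⟩ : Message k)] =
        (P.content i (x i) ((P.run x (m + 1)).view i)).length := by
      simp [Transcript.bits]
    omega

theorem bits_run_le_of_cost_le {x : Fin k → X} {T : ℕ} (h : P.cost x ≤ T) (m : ℕ) :
    (P.run x m).bits ≤ T := by
  have := (le_iSup (fun m : ℕ => ((P.run x m).bits : ℕ∞)) m).trans h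
  exact_mod_cast this

theorem speaker_run_eq_none_of_cost_le {x : Fin k → X} {T : ℕ} (h : P.cost x ≤ T) :
    P.speaker (P.run x T) = none := by
  by_contra h0
  have h1 := P.lt_bits_run_succ h0
  have h2 := P.bits_run_le_of_cost_le h (T + 1)
  omega

/-- What the reporting player announces after `T` rounds. -/
def answer (x : Fin k → X) (T : ℕ) : Out :=
  P.report (P.reporter (P.run x T)) (x (P.reporter (P.run x T)))
    ((P.run x T).view (P.reporter (P.run x T)))

theorem answer_eq_of_outputs {x : Fin k → X} {T : ℕ} (hT : P.speaker (P.run x T) = none) {a : Out}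
    (h : P.Outputs x a) : P.answer x T = a := by
  obtain ⟨m, hm, rfl⟩ := h
  have : P.run x T = P.run x m := by
    rcases le_total m T with hmT | hmT
    · obtain ⟨d, rfl⟩ := Nat.exists_eq_add_of_le hmT
      exact P.run_add_of_none hm d
    · obtain ⟨d, rfl⟩ := Nat.exists_eq_add_of_le hmT
      exact (P.run_add_of_none hT d).symm
  rw [answer, this]

/-- With input `a`, player `i` would have sent exactly those messages of `t` that are its own. -/
def Consistent (i : Fin k) (a : X) (t : Transcript k) : Prop :=
  ∀ u μ rest, t = u ++ μ :: rest → μ.src = i → μ = ⟨i, P.receiver i a u, P.content i a u⟩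

theorem Consistent.of_append {P : Protocol k X Out} {i : Fin k} {a : X} {t t' : Transcript k}
    (h : P.Consistent i a (t ++ t')) : P.Consistent i a t := by
  intro u μ rest hu hμ
  refine h u μ (rest ++ t') ?_ hμ
  rw [hu, List.append_assoc, List.cons_append]

theorem consistent_view_run (i : Fin k) (x : Fin k → X) (T : ℕ) :
    P.Consistent i (x i) ((P.run x T).view i) := by
  induction T with
  | zero => intro u μ rest h; simp [run, Transcript.view] at h
  | succ T ih =>
    rw [run_succ]
    cases h : P.speaker (P.run x T) with
    | none => rwa [P.step_of_none h]
    | some p =>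
      rw [P.step_of_some h, Transcript.view_append]
      intro u μ rest hu hμ
      set t := P.run x T
      set ν : Message k := ⟨p, P.receiver p (x p) (t.view p), P.content p (x p) (t.view p)⟩ with hν
      by_cases hin : ν.src = i ∨ ν.dst = i
      · have hv : Transcript.view [ν] i = [ν] := by simp [Transcript.view, hin]
        rw [hv] at hu
        rcases List.eq_nil_or_concat rest with rfl | ⟨rest', z, rfl⟩
        · obtain ⟨h1, h2⟩ := List.append_inj' hu rfl
          have h3 : ν = μ := by simpa using h2
          rw [← h3] at hμ ⊢
          have h4 : p = i := hμ
          subst h4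
          rw [← h1]
        · rw [List.concat_eq_append, ← List.cons_append, ← List.append_assoc] at hu
          obtain ⟨h1, h2⟩ := List.append_inj' hu rfl
          exact ih u μ rest' h1 hμ
      · have hv : Transcript.view [ν] i = [] := by simpa [Transcript.view] using hin
        rw [hv, List.append_nil] at hu
        exact ih u μ rest hu hμ

/-- The rectangle property: the view of player `i` determines, together with the inputs of the
others, the whole transcript, whichever consistent input player `i` has. -/
theorem run_eq_of_consistent {i : Fin k} {x x' : Fin k → X} (hx : ∀ p, p ≠ i → x p = x' p) (T : ℕ)
    (h : P.Consistent i (x i) ((P.run x' T).view i)) : P.run x T = P.run x' T := by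
  induction T with
  | zero => rfl
  | succ T ih =>
    rw [run_succ] at h
    rw [run_succ, run_succ]
    cases hs : P.speaker (P.run x' T) with
    | none =>
      rw [P.step_of_none hs] at h ⊢
      rw [ih h, P.step_of_none hs]
    | some p =>
      rw [P.step_of_some hs] at h ⊢
      rw [Transcript.view_append] at h
      rw [ih h.of_append, P.step_of_some hs]
      by_cases hp : p = i
      · subst hp
        congr 2
        refine (h ((P.run x' T).view p) _ [] ?_ rfl).symm
        congr 1
        simp [Transcript.view]
      · rw [hx p hp]

end Protocol

end Protocols

/-! ### The law of the hard inputs -/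

section Law

variable {ι : Type} [Fintype ι]

/-- The law of a vector of independent bits, each `1` with probability `1 / 4`. -/
noncomputable def priorWeight (y : ι → Bool) : ℝ := ∏ j, if y j then 1 / 4 else 3 / 4

/-- The law of a random subset of the complement of `y`, which contains each of its elements with
probability `1 / 3`, independently. -/
noncomputable def playerWeight (y x : ι → Bool) : ℝ :=
  ∏ j, if y j then (if x j then 0 else 1) else (if x j then 1 / 3 else 2 / 3)

theorem priorWeight_nonneg (y : ι → Bool) : 0 ≤ priorWeight y :=
  Finset.prod_nonneg fun j _ => by split_ifs <;> norm_num

theorem playerWeight_nonneg (y x : ι → Bool) : 0 ≤ playerWeight y x :=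
  Finset.prod_nonneg fun j _ => by split_ifs <;> norm_num

theorem eq_false_of_playerWeight_ne_zero {y x : ι → Bool} (h : playerWeight y x ≠ 0) {j : ι}
    (hj : y j = true) : x j = false := by
  have := Finset.prod_ne_zero_iff.1 h j (mem_univ j)
  rw [if_pos hj] at this
  by_contra hx
  simp [hx] at this

variable [DecidableEq ι]

theorem sum_prod_apply (q : ι → Bool → ℝ) :
    ∑ u : ι → Bool, ∏ j, q j (u j) = ∏ j, (q j false + q j true) := by
  have h := Finset.prod_univ_sum (fun _ : ι => (univ : Finset Bool)) q
  rw [Fintype.piFinset_univ] at h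
  rw [← h]
  simp [add_comm]

theorem sum_priorWeight : ∑ y : ι → Bool, priorWeight y = 1 := by
  rw [show (∑ y : ι → Bool, priorWeight y) =
    ∏ _j : ι, ((if false then (1 / 4 : ℝ) else 3 / 4) + if true then 1 / 4 else 3 / 4) from
    sum_prod_apply fun _ b => if b then 1 / 4 else 3 / 4]
  exact Finset.prod_eq_one fun j _ => by norm_num

theorem sum_playerWeight (y : ι → Bool) : ∑ x, playerWeight y x = 1 := by
  unfold playerWeight
  rw [sum_prod_apply fun j b =>
    if y j then (if b then (0 : ℝ) else 1) else (if b then 1 / 3 else 2 / 3)]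
  refine Finset.prod_eq_one fun j _ => ?_
  cases y j <;> norm_num

theorem priorWeight_mul_playerWeight (y x : ι → Bool) :
    priorWeight y * playerWeight y x = 𝔼 D : ι → Bool, 𝔼 u : ι → Bool,
      if mask D u = x ∧ mask (fun i => !D i) u = y then 1 else 0 := by
  have h : ∀ D u : ι → Bool, (if mask D u = x ∧ mask (fun i => !D i) u = y then (1 : ℝ) else 0) =
      ∏ j, if (D j && u j) = x j ∧ (!D j && u j) = y j then 1 else 0 := by
    intro D u
    rw [Finset.prod_boole]
    congr 1
    simp only [funext_iff, mask, mem_univ, forall_const, forall_and]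
  simp_rw [h]
  simp_rw [fun D : ι → Bool => expect_prod_apply fun j b =>
    if (D j && b) = x j ∧ (!D j && b) = y j then (1 : ℝ) else 0]
  rw [expect_prod_apply fun j d =>
    ((if (d && false) = x j ∧ (!d && false) = y j then (1 : ℝ) else 0) +
      if (d && true) = x j ∧ (!d && true) = y j then 1 else 0) / 2]
  rw [priorWeight, playerWeight, ← Finset.prod_mul_distrib]
  refine Finset.prod_congr rfl fun j _ => ?_
  cases x j <;> cases y j <;> norm_num

theorem expect_mask_eq_sum (G : (ι → Bool) → (ι → Bool) → ℝ) :
    𝔼 D : ι → Bool, 𝔼 u : ι → Bool, G (mask D u) (mask (fun i => !D i) u) =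
      ∑ y, priorWeight y * ∑ x, playerWeight y x * G x y := by
  have h : ∀ D u : ι → Bool, G (mask D u) (mask (fun i => !D i) u) =
      ∑ y, ∑ x, (if mask D u = x ∧ mask (fun i => !D i) u = y then 1 else 0) * G x y := by
    intro D u
    simp [ite_and]
  simp_rw [h, Finset.expect_sum_comm, ← Finset.expect_mul, ← priorWeight_mul_playerWeight,
    Finset.mul_sum, mul_assoc]

/-- Planting `(0, 1)` in one coordinate costs at most a factor `4`. -/
theorem expect_update_le (j : ι) {G : (ι → Bool) → (ι → Bool) → ℝ} (hG : ∀ x y, 0 ≤ G x y) :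
    𝔼 D : ι → Bool, 𝔼 u : ι → Bool,
        G (update (mask D u) j false) (update (mask (fun i => !D i) u) j true) ≤
      4 * 𝔼 D : ι → Bool, 𝔼 u : ι → Bool, G (mask D u) (mask (fun i => !D i) u) := by
  rw [expect_eq_expect_update j fun D =>
    𝔼 u : ι → Bool, G (mask D u) (mask (fun i => !D i) u), Finset.mul_expect]
  refine Finset.expect_le_expect fun D _ => ?_
  have h1 : 0 ≤ 𝔼 u, G (mask (update D j true) u) (mask (fun i => !(update D j true) i) u) :=
    Finset.expect_nonneg fun u _ => hG _ _
  have h2 : (𝔼 u, G (update (mask D u) j false) (update (mask (fun i => !D i) u) j true)) ≤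
      2 * 𝔼 u, G (mask (update D j false) u) (mask (fun i => !(update D j false) i) u) := by
    rw [expect_eq_expect_update j fun u =>
      G (mask (update D j false) u) (mask (fun i => !(update D j false) i) u), Finset.mul_expect]
    refine Finset.expect_le_expect fun u _ => ?_
    simp only [mask_update_update, mask_not_update_update, Bool.false_and, Bool.not_false,
      Bool.true_and]
    linarith [hG (update (mask D u) j false) (update (mask (fun i => !D i) u) j false)]
  linarith

end Law

section Resample

/-- Resampling one coordinate of a point with independent identically distributed coordinates. -/
theorem sum_mul_sum_prod_update {A κ : Type} [Fintype A] [Fintype κ] [DecidableEq κ]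
    (w : A → ℝ) (hw : ∑ a, w a = 1) (i : κ) (G : (κ → A) → ℝ) :
    ∑ a, w a * ∑ x : κ → A, (∏ p, w (x p)) * G (update x i a) =
      ∑ x : κ → A, (∏ p, w (x p)) * G x := by
  classical
  -- exchange the fresh value and the old one
  let e : A × (κ → A) → A × (κ → A) := fun p => (p.2 i, update p.2 i p.1)
  have he : Function.Involutive e := by
    rintro ⟨a, x⟩
    simp [e]
  have hW : ∀ a (x : κ → A), w (x i) * ∏ p, w (update x i a p) = w a * ∏ p, w (x p) := by
    intro a x
    rw [← Finset.mul_prod_erase univ (fun p => w (update x i a p)) (mem_univ i),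
      ← Finset.mul_prod_erase univ (fun p => w (x p)) (mem_univ i), update_self]
    have : ∏ p ∈ univ.erase i, w (update x i a p) = ∏ p ∈ univ.erase i, w (x p) :=
      Finset.prod_congr rfl fun p hp => by rw [update_of_ne (Finset.ne_of_mem_erase hp)]
    rw [this]
    ring
  calc ∑ a, w a * ∑ x : κ → A, (∏ p, w (x p)) * G (update x i a)
      = ∑ p : A × (κ → A), w p.1 * (∏ q, w (p.2 q)) * G (update p.2 i p.1) := by
        rw [Fintype.sum_prod_type]
        simp_rw [Finset.mul_sum, mul_assoc]
    _ = ∑ p : A × (κ → A), w p.1 * (∏ q, w (p.2 q)) * G p.2 := by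
        refine Fintype.sum_equiv he.toPerm _ _ fun p => ?_
        simp only [Function.Involutive.coe_toPerm, e, hW]
    _ = ∑ x : κ → A, (∏ p, w (x p)) * G x := by
        rw [Fintype.sum_prod_type]
        simp_rw [mul_assoc, ← Finset.mul_sum]
        rw [← Finset.sum_mul, hw, one_mul]

end Resample

section PlayersLaw

variable {k m : ℕ}

/-- Given `y`, the players draw independent random subsets of its complement. The special player
draws one too and ignores it, which keeps the players interchangeable. -/
noncomputable def playersWeight (y : Fin m → Bool) (x : Fin k → Fin m → Bool) : ℝ :=
  ∏ p, playerWeight y (x p)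

theorem playersWeight_nonneg (y : Fin m → Bool) (x : Fin k → Fin m → Bool) :
    0 ≤ playersWeight y x := Finset.prod_nonneg fun _ _ => playerWeight_nonneg _ _

theorem sum_playersWeight (y : Fin m → Bool) :
    ∑ x : Fin k → Fin m → Bool, playersWeight y x = 1 := by
  have h := Finset.prod_univ_sum (fun _ : Fin k => (univ : Finset (Fin m → Bool)))
    fun _ x => playerWeight y x
  rw [Fintype.piFinset_univ] at h
  simp only [playersWeight, ← h, sum_playerWeight, Finset.prod_const_one]

theorem eq_false_of_playersWeight_ne_zero {y : Fin m → Bool} {x : Fin k → Fin m → Bool}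
    (h : playersWeight y x ≠ 0) (p : Fin k) {j : Fin m} (hj : y j = true) : x p j = false :=
  eq_false_of_playerWeight_ne_zero (Finset.prod_ne_zero_iff.1 h p (mem_univ p)) hj

/-- The expectation of `G` when `y` is random and the players draw random subsets of its
complement. -/
noncomputable def disjointMean (k m : ℕ) (G : (Fin m → Bool) → (Fin k → Fin m → Bool) → ℝ) : ℝ :=
  ∑ y, priorWeight y * ∑ x, playersWeight y x * G y x

theorem disjointMean_mono {G G' : (Fin m → Bool) → (Fin k → Fin m → Bool) → ℝ}
    (h : ∀ y x, playersWeight y x ≠ 0 → G y x ≤ G' y x) :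
    disjointMean k m G ≤ disjointMean k m G' := by
  refine Finset.sum_le_sum fun y _ => mul_le_mul_of_nonneg_left
    (Finset.sum_le_sum fun x _ => ?_) (priorWeight_nonneg y)
  by_cases h0 : playersWeight y x = 0
  · simp [h0]
  · exact mul_le_mul_of_nonneg_left (h y x h0) (playersWeight_nonneg y x)

theorem disjointMean_const (c : ℝ) : disjointMean k m (fun _ _ => c) = c := by
  simp_rw [disjointMean, ← Finset.sum_mul, sum_playersWeight, ← Finset.sum_mul, sum_priorWeight,
    one_mul]

theorem disjointMean_add (G G' : (Fin m → Bool) → (Fin k → Fin m → Bool) → ℝ) :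
    disjointMean k m (fun y x => G y x + G' y x) = disjointMean k m G + disjointMean k m G' := by
  simp_rw [disjointMean, mul_add, Finset.sum_add_distrib, mul_add, Finset.sum_add_distrib]

theorem disjointMean_mul_const (G : (Fin m → Bool) → (Fin k → Fin m → Bool) → ℝ) (c : ℝ) :
    disjointMean k m (fun y x => G y x * c) = disjointMean k m G * c := by
  simp_rw [disjointMean, Finset.sum_mul, mul_assoc, Finset.sum_mul, mul_assoc]

theorem sum_disjointMean (I : Finset (Fin k))
    (G : Fin k → (Fin m → Bool) → (Fin k → Fin m → Bool) → ℝ) :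
    ∑ i ∈ I, disjointMean k m (G i) = disjointMean k m (fun y x => ∑ i ∈ I, G i y x) := by
  simp_rw [disjointMean]
  rw [Finset.sum_comm]
  simp_rw [← Finset.mul_sum]
  refine Finset.sum_congr rfl fun y _ => ?_
  rw [Finset.sum_comm]
  simp_rw [← Finset.mul_sum]

/-- For every player `i`, the pair of `y` and the set of player `i` is distributed
as `(mask Dᶜ u, mask D u)`. -/
theorem expect_mask_sum_players (i : Fin k)
    (G : (Fin m → Bool) → (Fin k → Fin m → Bool) → ℝ) :
    𝔼 D : Fin m → Bool, 𝔼 u : Fin m → Bool,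
        ∑ x : Fin k → Fin m → Bool, playersWeight (mask (fun i => !D i) u) x *
          G (mask (fun i => !D i) u) (update x i (mask D u)) =
      disjointMean k m G := by
  rw [expect_mask_eq_sum fun a y => ∑ x : Fin k → Fin m → Bool, playersWeight y x *
    G y (update x i a)]
  refine Finset.sum_congr rfl fun y _ => ?_
  congr 1
  exact sum_mul_sum_prod_update (playerWeight y) (sum_playerWeight y) i (G y)

end PlayersLaw

/-! ### The hard inputs -/

section HardInput

variable {k m r n : ℕ}

/-- Player `p₀` holds one of two elements for each `j`, according to `y j`, and some padding; so it
always holds `m + r` elements. The other players may hold those elements `(j, true)` that `p₀` lacks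
exactly when `y j` is true. -/
def hardInput (φ : (Fin m × Bool) ⊕ Fin r ↪ Fin n) (p₀ : Fin k) (y : Fin m → Bool)
    (x : Fin k → Fin m → Bool) (p : Fin k) : Finset (Fin n) :=
  if p = p₀ then univ.image (Sum.elim (fun j => φ (.inl (j, !y j))) fun e => φ (.inr e))
  else (univ.filter fun j => x p j = true).image fun j => φ (.inl (j, true))

theorem distinctCount_hardInput (φ : (Fin m × Bool) ⊕ Fin r ↪ Fin n) (p₀ : Fin k)
    (y : Fin m → Bool) (x : Fin k → Fin m → Bool) :
    distinctCount (hardInput φ p₀ y x) =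
      m + r + (univ.filter fun j => y j = true ∧ ∃ p, p ≠ p₀ ∧ x p j = true).card := by
  have h : univ.biUnion (hardInput φ p₀ y x) =
      univ.image (Sum.elim (fun j => φ (.inl (j, !y j))) fun e => φ (.inr e)) ∪
        (univ.filter fun j => y j = true ∧ ∃ p, p ≠ p₀ ∧ x p j = true).image
          fun j => φ (.inl (j, true)) := by
    ext e
    simp only [mem_biUnion, mem_univ, true_and, mem_union, hardInput]
    constructor
    · rintro ⟨p, hp⟩
      split_ifs at hp with h
      · exact Or.inl hp
      · obtain ⟨j, hj, rfl⟩ := mem_image.1 hp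
        have hj' : x p j = true := (mem_filter.1 hj).2
        cases hy : y j
        · exact Or.inl (mem_image.2 ⟨.inl j, mem_univ _, by simp [hy]⟩)
        · exact Or.inr (mem_image.2 ⟨j, mem_filter.2 ⟨mem_univ _, hy, p, h, hj'⟩, rfl⟩)
    · rintro (he | he)
      · exact ⟨p₀, by rwa [if_pos rfl]⟩
      · obtain ⟨j, hj, rfl⟩ := mem_image.1 he
        obtain ⟨hy, p, hp, hx⟩ := (mem_filter.1 hj).2
        refine ⟨p, ?_⟩
        rw [if_neg hp]
        exact mem_image.2 ⟨j, mem_filter.2 ⟨mem_univ _, hx⟩, rfl⟩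
  rw [distinctCount, h, Finset.card_union_of_disjoint, Finset.card_image_of_injective,
    Finset.card_image_of_injective]
  · simp
  · intro j j' h
    simpa using h
  · rintro (j | e) (j' | e') h
    · simp only [Sum.elim_inl, EmbeddingLike.apply_eq_iff_eq, Sum.inl.injEq, Prod.mk.injEq] at h
      rw [h.1]
    · simp at h
    · simp at h
    · simpa using h
  · rw [Finset.disjoint_left]
    intro e h1 h2
    obtain ⟨j, hj, rfl⟩ := mem_image.1 h2
    have hy := (mem_filter.1 hj).2.1
    obtain ⟨j' | e, -, h⟩ := mem_image.1 h1
    · simp only [Sum.elim_inl, EmbeddingLike.apply_eq_iff_eq, Sum.inl.injEq, Prod.mk.injEq] at h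
      rw [h.1, hy] at h
      simp at h
    · simp at h

theorem distinctCount_hardInput_of_disjoint (φ : (Fin m × Bool) ⊕ Fin r ↪ Fin n) (p₀ : Fin k)
    {y : Fin m → Bool} {x : Fin k → Fin m → Bool} (h : ∀ p j, y j = true → x p j = false) :
    distinctCount (hardInput φ p₀ y x) = m + r := by
  rw [distinctCount_hardInput, Finset.card_eq_zero.2, add_zero]
  refine Finset.filter_eq_empty_iff.2 ?_
  rintro j - ⟨hy, p, -, hx⟩
  rw [h p j hy] at hx
  exact Bool.noConfusion hx

theorem distinctCount_hardInput_of_hit (φ : (Fin m × Bool) ⊕ Fin r ↪ Fin n) {p₀ i : Fin k}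
    (hi : i ≠ p₀) {y : Fin m → Bool} {x : Fin k → Fin m → Bool} {j : Fin m} (hy : y j = true)
    (hx : x i j = true) (h : ∀ p j', j' ≠ j → y j' = true → x p j' = false) :
    distinctCount (hardInput φ p₀ y x) = m + r + 1 := by
  rw [distinctCount_hardInput, Finset.card_eq_one.2 ⟨j, ?_⟩]
  ext j'
  simp only [mem_filter, mem_univ, true_and, mem_singleton]
  constructor
  · rintro ⟨hy', p, -, hx'⟩
    by_contra hne
    rw [h p j' hne hy'] at hx'
    exact Bool.noConfusion hx'
  · rintro rfl
    exact ⟨hy, i, hi, hx⟩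

end HardInput

/-! ### The view of one player -/

section Rectangles

variable {A B V : Type} [DecidableEq V]

/-- If the compatibility `C a v` of a value `v` with the first argument is all that matters, then
the level sets of `view`, and their intersections with `Q`, are rectangles. -/
theorem ite_mul_ite_exists (view : A → B → V) (C : A → V → Prop) (Q : A → B → Prop)
    [∀ a v, Decidable (C a v)] [∀ v b, Decidable (∃ a', view a' b = v ∧ Q a' b)]
    [∀ a b, Decidable (Q a b)]
    (hC : ∀ a b, C a (view a b))
    (hQ : ∀ a a' b, C a (view a' b) → view a b = view a' b ∧ (Q a b ↔ Q a' b))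
    (a : A) (b : B) (v : V) :
    ((if C a v then 1 else 0) * if ∃ a', view a' b = v ∧ Q a' b then 1 else 0 : ℝ) =
      if view a b = v then (if Q a b then 1 else 0) else 0 := by
  by_cases hv : view a b = v
  · subst hv
    rw [if_pos (hC a b), if_pos rfl, one_mul]
    congr 1
    refine propext ⟨?_, fun h => ⟨a, rfl, h⟩⟩
    rintro ⟨a', h1, h2⟩
    exact ((hQ a a' b (h1 ▸ hC a b)).2).2 h2
  · rw [if_neg hv]
    by_cases h1 : C a v
    · by_cases h2 : ∃ a', view a' b = v ∧ Q a' b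
      · obtain ⟨a', h3, -⟩ := h2
        exact absurd ((hQ a a' b (h3.symm ▸ h1)).1.trans h3) hv
      · rw [if_neg h2, mul_zero]
    · rw [if_neg h1, zero_mul]

/-- Summing out the rectangles, with random `b`, gives the law of `view a b` on the event `Q`. -/
theorem sum_rectangles [Fintype B] (view : A → B → V) (C : A → V → Prop) (Q : A → B → Prop)
    [∀ a v, Decidable (C a v)] [∀ v b, Decidable (∃ a', view a' b = v ∧ Q a' b)]
    [∀ a b, Decidable (Q a b)]
    (hC : ∀ a b, C a (view a b))
    (hQ : ∀ a a' b, C a (view a' b) → view a b = view a' b ∧ (Q a b ↔ Q a' b))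
    (s : Finset V) (hs : ∀ a b, view a b ∈ s) (W : B → ℝ) (c : V → ℝ) (a : A) :
    ∑ v ∈ s, (if C a v then 1 else 0) *
        (∑ b, W b * if ∃ a', view a' b = v ∧ Q a' b then 1 else 0) * c v =
      ∑ b, W b * ((if Q a b then 1 else 0) * c (view a b)) := by
  have h : ∀ v b, (if C a v then 1 else 0) *
      (W b * if ∃ a', view a' b = v ∧ Q a' b then 1 else 0) * c v =
      if view a b = v then W b * ((if Q a b then 1 else 0) * c v) else 0 := by
    intro v b
    have := ite_mul_ite_exists view C Q hC hQ a b v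
    calc _ = W b * (((if C a v then 1 else 0) * if ∃ a', view a' b = v ∧ Q a' b then 1 else 0 : ℝ)
          * c v) := by ring
      _ = _ := by rw [this]; split_ifs <;> simp
  simp_rw [Finset.mul_sum, Finset.sum_mul, h]
  rw [Finset.sum_comm]
  refine Finset.sum_congr rfl fun b _ => ?_
  rw [Finset.sum_ite_eq, if_pos (hs a b)]

end Rectangles

section OnePlayer

variable {k m r n : ℕ}

theorem hardInput_update_self (φ : (Fin m × Bool) ⊕ Fin r ↪ Fin n) {p₀ i : Fin k} (hi : i ≠ p₀)
    (y : Fin m → Bool) (x : Fin k → Fin m → Bool) (a : Fin m → Bool) :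
    hardInput φ p₀ y (update x i a) i =
      (univ.filter fun j => a j = true).image fun j => φ (.inl (j, true)) := by
  simp [hardInput, hi]

theorem hardInput_update_of_ne (φ : (Fin m × Bool) ⊕ Fin r ↪ Fin n) {p₀ i p : Fin k} (hp : p ≠ i)
    (y : Fin m → Bool) (x : Fin k → Fin m → Bool) (a a' : Fin m → Bool) :
    hardInput φ p₀ y (update x i a) p = hardInput φ p₀ y (update x i a') p := by
  simp [hardInput, hp]

open Classical in
/-- The probability that a player other than `i` announces `N`, when player `i` has the set `a`. -/
noncomputable def acceptProb (P : Protocol k (Finset (Fin n)) ℕ) (T N : ℕ)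
    (φ : (Fin m × Bool) ⊕ Fin r ↪ Fin n) (p₀ i : Fin k) (a y : Fin m → Bool) : ℝ :=
  ∑ x : Fin k → Fin m → Bool, playersWeight y x *
    if P.reporter (P.run (hardInput φ p₀ y (update x i a)) T) ≠ i ∧
      P.answer (hardInput φ p₀ y (update x i a)) T = N then 1 else 0

/-- If player `i` takes part in few messages, then most hits of `y` by its set go unnoticed. -/
theorem sum_acceptProb_sub_le (P : Protocol k (Finset (Fin n)) ℕ) (T N : ℕ)
    (φ : (Fin m × Bool) ⊕ Fin r ↪ Fin n) {p₀ i : Fin k} (hi : i ≠ p₀) {η : ℝ} (h0 : 0 < η)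
    (h1 : η < 1) {l : ℝ} (hl : 0 < l) :
    ∑ j, 𝔼 D : Fin m → Bool, 𝔼 u : Fin m → Bool,
        (acceptProb P T N φ p₀ i (update (mask D u) j false)
            (update (mask (fun i => !D i) u) j true) -
          acceptProb P T N φ p₀ i (update (mask D u) j true)
            (update (mask (fun i => !D i) u) j true)) ≤
      24 * l * (-Real.log (1 - η) +
        disjointMean k m (fun y x => (((P.run (hardInput φ p₀ y x) T).view i).bits : ℝ)) *
          (-Real.log (η / 2) + 2 * Real.log 4 + 2 * Real.log k)) + 2 * m / l := by
  classical
  have hk : 0 < k := i.pos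
  let view : (Fin m → Bool) → (Fin m → Bool) → (Fin k → Fin m → Bool) → Transcript k :=
    fun y a x => (P.run (hardInput φ p₀ y (update x i a)) T).view i
  let C : (Fin m → Bool) → Transcript k → Prop := fun a v =>
    P.Consistent i ((univ.filter fun j => a j = true).image fun j => φ (.inl (j, true))) v
  let Q : (Fin m → Bool) → (Fin m → Bool) → (Fin k → Fin m → Bool) → Prop := fun y a x =>
    P.reporter (P.run (hardInput φ p₀ y (update x i a)) T) ≠ i ∧
      P.answer (hardInput φ p₀ y (update x i a)) T = N
  let s : Finset (Transcript k) :=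
    univ.image fun q : (Fin m → Bool) × (Fin m → Bool) × (Fin k → Fin m → Bool) =>
      view q.1 q.2.1 q.2.2
  have hs : ∀ y a x, view y a x ∈ s := fun y a x => mem_image.2 ⟨(y, a, x), mem_univ _, rfl⟩
  have hC : ∀ y a x, C a (view y a x) := by
    intro y a x
    have := P.consistent_view_run i (hardInput φ p₀ y (update x i a)) T
    rwa [hardInput_update_self φ hi] at this
  have hrun : ∀ y a a' x, C a (view y a' x) →
      P.run (hardInput φ p₀ y (update x i a)) T = P.run (hardInput φ p₀ y (update x i a')) T := by
    intro y a a' x h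
    refine P.run_eq_of_consistent (i := i) (fun p hp => hardInput_update_of_ne φ hp y x a a') T ?_
    rwa [hardInput_update_self φ hi]
  have hview : ∀ y a a' x, C a (view y a' x) → view y a x = view y a' x := by
    intro y a a' x h
    simp only [view, hrun y a a' x h]
  have hQ : ∀ y a a' x, C a (view y a' x) → (Q y a x ↔ Q y a' x) := by
    intro y a a' x h
    simp only [Q, Protocol.answer, hrun y a a' x h]
    refine and_congr_right fun hne => ?_
    rw [hardInput_update_of_ne φ hne y x a a']
  let α : Transcript k → (Fin m → Bool) → ℝ := fun v a => if C a v then 1 else 0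
  let β : Transcript k → (Fin m → Bool) → ℝ := fun v y => ∑ x : Fin k → Fin m → Bool,
    playersWeight y x * if ∃ a', view y a' x = v ∧ True then 1 else 0
  let ρ : Transcript k → (Fin m → Bool) → ℝ := fun v y => ∑ x : Fin k → Fin m → Bool,
    playersWeight y x * if ∃ a', view y a' x = v ∧ Q y a' x then 1 else 0
  have hαβ : ∀ a y (c : Transcript k → ℝ), ∑ v ∈ s, α v a * β v y * c v =
      ∑ x : Fin k → Fin m → Bool, playersWeight y x * c (view y a x) := by
    intro a y c
    have := sum_rectangles (view y) C (fun _ _ => True) (hC y)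
      (fun a a' x h => ⟨hview y a a' x h, Iff.rfl⟩) s (hs y) (playersWeight y) c a
    simpa only [if_true, one_mul] using this
  have hαρ : ∀ a y, ∑ v ∈ s, α v a * ρ v y = acceptProb P T N φ p₀ i a y := by
    intro a y
    have := sum_rectangles (view y) C (Q y) (hC y)
      (fun a a' x h => ⟨hview y a a' x h, hQ y a a' x h⟩) s (hs y) (playersWeight y)
      (fun _ => 1) a
    simp only [mul_one] at this
    exact this
  have hα0 : ∀ v a, 0 ≤ α v a := fun v a => by simp only [α]; split_ifs <;> norm_num
  have hα1 : ∀ v a, α v a ≤ 1 := fun v a => by simp only [α]; split_ifs <;> norm_num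
  have hβ0 : ∀ v y, 0 ≤ β v y := fun v y => Finset.sum_nonneg fun x _ =>
    mul_nonneg (playersWeight_nonneg _ _) (by split_ifs <;> norm_num)
  have hβ1 : ∀ v y, β v y ≤ 1 := by
    intro v y
    rw [← sum_playersWeight (k := k) y]
    refine Finset.sum_le_sum fun x _ => mul_le_of_le_one_right (playersWeight_nonneg _ _) ?_
    split_ifs <;> norm_num
  have hρ0 : ∀ v y, 0 ≤ ρ v y := fun v y => Finset.sum_nonneg fun x _ =>
    mul_nonneg (playersWeight_nonneg _ _) (by split_ifs <;> norm_num)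
  have hρβ : ∀ v y, ρ v y ≤ β v y := by
    intro v y
    refine Finset.sum_le_sum fun x _ => mul_le_mul_of_nonneg_left ?_ (playersWeight_nonneg _ _)
    by_cases h : ∃ a', view y a' x = v ∧ Q y a' x
    · obtain ⟨a', h1, h2⟩ := h
      rw [if_pos ⟨a', h1, h2⟩, if_pos ⟨a', h1, trivial⟩]
    · rw [if_neg h]
      split_ifs <;> norm_num
  have main := two_party_bound s α β ρ (viewWeight η) hα0 hα1 hβ0 hβ1
    (fun a y => by
      have := hαβ a y fun _ => 1
      simpa only [mul_one, sum_playersWeight] using this)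
    hρ0 hρβ (viewWeight_pos hk h0 h1) (sum_viewWeight_le hk h0 h1 s) hl
  simp only [sub_mul, Finset.sum_sub_distrib, hαρ] at main
  simp only [hαβ, Fintype.card_fin] at main
  rw [expect_mask_sum_players i fun y x =>
    -Real.log (viewWeight η ((P.run (hardInput φ p₀ y x) T).view i))] at main
  refine main.trans ?_
  rw [← disjointMean_mul_const]
  have : disjointMean k m (fun y x =>
      -Real.log (viewWeight η ((P.run (hardInput φ p₀ y x) T).view i))) ≤
      -Real.log (1 - η) + disjointMean k m (fun y x =>
        (((P.run (hardInput φ p₀ y x) T).view i).bits : ℝ) *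
          (-Real.log (η / 2) + 2 * Real.log 4 + 2 * Real.log k)) := by
    rw [← disjointMean_const (k := k) (m := m) (-Real.log (1 - η)), ← disjointMean_add]
    refine disjointMean_mono fun y x _ => neg_log_viewWeight_le hk h0 h1 _ fun μ hμ => ?_
    exact P.body_ne_nil_of_mem_run _ _ μ (List.mem_of_mem_filter hμ)
  gcongr

end OnePlayer

/-! ### Averaging over the random tapes -/

section Averaging

open MeasureTheory

/-- `f` is integrable with integral at most `c`. -/
def MeanLE {Ω : Type} [MeasurableSpace Ω] (μ : Measure Ω) (f : Ω → ℝ) (c : ℝ) : Prop :=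
  Integrable f μ ∧ ∫ ω, f ω ∂μ ≤ c

variable {Ω : Type} [MeasurableSpace Ω] {μ : Measure Ω}

theorem MeanLE.sum {κ : Type} {s : Finset κ} {f : κ → Ω → ℝ} {c : κ → ℝ}
    (h : ∀ i ∈ s, MeanLE μ (f i) (c i)) :
    MeanLE μ (fun ω => ∑ i ∈ s, f i ω) (∑ i ∈ s, c i) := by
  refine ⟨integrable_finsetSum s fun i hi => (h i hi).1, ?_⟩
  rw [integral_finsetSum s fun i hi => (h i hi).1]
  exact Finset.sum_le_sum fun i hi => (h i hi).2

theorem MeanLE.const_mul {f : Ω → ℝ} {a c : ℝ} (ha : 0 ≤ a) (h : a ≠ 0 → MeanLE μ f c) :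
    MeanLE μ (fun ω => a * f ω) (a * c) := by
  rcases eq_or_ne a 0 with rfl | ha'
  · simp [MeanLE]
  replace h := h ha'
  refine ⟨h.1.const_mul a, ?_⟩
  rw [integral_const_mul]
  exact mul_le_mul_of_nonneg_left h.2 ha

theorem MeanLE.add {f g : Ω → ℝ} {a b : ℝ} (hf : MeanLE μ f a) (hg : MeanLE μ g b) :
    MeanLE μ (fun ω => f ω + g ω) (a + b) := by
  refine ⟨hf.1.add hg.1, ?_⟩
  rw [integral_add hf.1 hg.1]
  exact add_le_add hf.2 hg.2

theorem MeanLE.expect {κ : Type} [Fintype κ] [Nonempty κ] {f : κ → Ω → ℝ} {c : ℝ}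
    (h : ∀ i, MeanLE μ (f i) c) : MeanLE μ (fun ω => 𝔼 i, f i ω) c := by
  have h1 := (MeanLE.sum (s := univ) fun i _ => h i)
  replace h1 := MeanLE.const_mul (a := ((Fintype.card κ : ℝ)⁻¹)) (by positivity) fun _ => h1
  simp only [Finset.sum_const, Finset.card_univ, nsmul_eq_mul] at h1
  rw [inv_mul_cancel_left₀ (by positivity)] at h1
  simpa only [Fintype.expect_eq_sum_div_card, div_eq_inv_mul] using h1

/-- The failure event need not be measurable, so it is replaced by a measurable hull. -/
theorem MeanLE.indicator_toMeasurable [IsProbabilityMeasure μ] {s : Set Ω} {δ : ℝ} (hδ : 0 ≤ δ)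
    (h : μ s ≤ ENNReal.ofReal δ) : MeanLE μ ((toMeasurable μ s).indicator fun _ => (1 : ℝ)) δ := by
  have hm := measurableSet_toMeasurable μ s
  refine ⟨(integrable_const _).indicator hm, ?_⟩
  rw [integral_indicator_const _ hm, smul_eq_mul, mul_one, measureReal_def, measure_toMeasurable]
  exact ENNReal.toReal_le_of_le_ofReal hδ h

theorem MeanLE.exists_le [IsProbabilityMeasure μ] {f : Ω → ℝ} {c : ℝ} (h : MeanLE μ f c) :
    ∃ ω, f ω ≤ c := by
  obtain ⟨ω, hω⟩ := exists_le_integral h.1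
  exact ⟨ω, hω.trans h.2⟩

end Averaging

/-! ### The lower bound -/

section LowerBound

variable {k m r n : ℕ}

open Classical in
/-- The probability that player `i` is the one to report, when it has the set `a`. -/
noncomputable def reporterProb (P : Protocol k (Finset (Fin n)) ℕ) (T : ℕ)
    (φ : (Fin m × Bool) ⊕ Fin r ↪ Fin n) (p₀ i : Fin k) (a y : Fin m → Bool) : ℝ :=
  ∑ x : Fin k → Fin m → Bool, playersWeight y x *
    if P.reporter (P.run (hardInput φ p₀ y (update x i a)) T) = i then 1 else 0

/-- At most one player reports, so most of the players hardly ever do. -/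
theorem sum_reporterProb_le (P : Protocol k (Finset (Fin n)) ℕ) (T : ℕ)
    (φ : (Fin m × Bool) ⊕ Fin r ↪ Fin n) (p₀ : Fin k) (I : Finset (Fin k)) :
    ∑ i ∈ I, ∑ j, 𝔼 D : Fin m → Bool, 𝔼 u : Fin m → Bool,
      reporterProb P T φ p₀ i (update (mask D u) j false)
        (update (mask (fun i => !D i) u) j true) ≤ 4 * m := by
  classical
  have h1 : ∀ i ∈ I, ∑ j, 𝔼 D : Fin m → Bool, 𝔼 u : Fin m → Bool,
      reporterProb P T φ p₀ i (update (mask D u) j false)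
        (update (mask (fun i => !D i) u) j true) ≤
      4 * m * disjointMean k m fun y x =>
        if P.reporter (P.run (hardInput φ p₀ y x) T) = i then 1 else 0 := by
    intro i _
    rw [← expect_mask_sum_players i]
    calc _ ≤ ∑ _j : Fin m, 4 * 𝔼 D : Fin m → Bool, 𝔼 u : Fin m → Bool,
          reporterProb P T φ p₀ i (mask D u) (mask (fun i => !D i) u) := by
          refine Finset.sum_le_sum fun j _ =>
            expect_update_le j (G := reporterProb P T φ p₀ i) fun a y => ?_
          refine Finset.sum_nonneg fun x _ => mul_nonneg (playersWeight_nonneg _ _) ?_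
          split_ifs <;> norm_num
      _ = _ := by
          rw [Finset.sum_const, Finset.card_univ, Fintype.card_fin, nsmul_eq_mul]
          unfold reporterProb
          ring
  refine (Finset.sum_le_sum h1).trans ?_
  rw [← Finset.mul_sum, sum_disjointMean]
  have h2 : disjointMean k m (fun y x => ∑ i ∈ I,
      if P.reporter (P.run (hardInput φ p₀ y x) T) = i then (1 : ℝ) else 0) ≤ 1 := by
    refine le_trans (disjointMean_mono fun y x _ => ?_) (disjointMean_const (k := k) (m := m) 1).le
    rw [Finset.sum_ite_eq]
    split_ifs <;> norm_num
  exact mul_le_of_le_one_right (by positivity) h2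

/-- Planting `(0, 1)` in coordinate `j` of the sets of player `i` and of `p₀` keeps all the players
disjoint from `y`. -/
theorem distinctCount_planted_false (φ : (Fin m × Bool) ⊕ Fin r ↪ Fin n) (p₀ i : Fin k)
    (j : Fin m) (D u : Fin m → Bool) {x : Fin k → Fin m → Bool}
    (hx : playersWeight (update (mask (fun i => !D i) u) j true) x ≠ 0) :
    distinctCount (hardInput φ p₀ (update (mask (fun i => !D i) u) j true)
      (update x i (update (mask D u) j false))) = m + r := by
  refine distinctCount_hardInput_of_disjoint φ p₀ fun p j' hy => ?_
  by_cases hp : p = i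
  · subst hp
    by_cases hj : j' = j
    · subst hj; simp
    · rw [update_of_ne hj] at hy
      rw [update_self, update_of_ne hj]
      revert hy
      simp only [mask]
      cases D j' <;> simp
  · rw [update_of_ne hp]
    exact eq_false_of_playersWeight_ne_zero hx p hy

/-- Planting `(1, 1)` creates exactly one hit. -/
theorem distinctCount_planted_true (φ : (Fin m × Bool) ⊕ Fin r ↪ Fin n) {p₀ i : Fin k}
    (hi : i ≠ p₀) (j : Fin m) (D u : Fin m → Bool) {x : Fin k → Fin m → Bool}
    (hx : playersWeight (update (mask (fun i => !D i) u) j true) x ≠ 0) :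
    distinctCount (hardInput φ p₀ (update (mask (fun i => !D i) u) j true)
      (update x i (update (mask D u) j true))) = m + r + 1 := by
  refine distinctCount_hardInput_of_hit φ hi (j := j) (by simp) (by simp) fun p j' hj hy => ?_
  by_cases hp : p = i
  · subst hp
    rw [update_of_ne hj] at hy
    rw [update_self, update_of_ne hj]
    revert hy
    simp only [mask]
    cases D j' <;> simp
  · rw [update_of_ne hp]
    exact eq_false_of_playersWeight_ne_zero hx p hy

/-- A protocol that errs on few of the planted inputs (`err S` bounds the indicator of an error
on `S`) has much communication: it must notice a hit by almost any player. -/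
theorem communication_ge_of_errors (P : Protocol k (Finset (Fin n)) ℕ) (T : ℕ)
    (φ : (Fin m × Bool) ⊕ Fin r ↪ Fin n) (p₀ : Fin k)
    (D₀ : Set (Fin k → Finset (Fin n))) (hD₀ : ∀ S, distinctCount S = m + r → S ∈ D₀)
    (hD₁ : ∀ S, distinctCount S = m + r + 1 → S ∈ D₀) (hcost : ∀ S ∈ D₀, P.cost S ≤ T)
    (err : (Fin k → Finset (Fin n)) → ℝ) (herr0 : ∀ S, 0 ≤ err S)
    (herr : ∀ S, ¬ P.Outputs S (distinctCount S) → 1 ≤ err S) {η : ℝ} (h0 : 0 < η) (h1 : η < 1)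
    {l : ℝ} (hl : 0 < l) :
    (k - 1) * m - (∑ i ∈ univ.erase p₀, ∑ j, 𝔼 D : Fin m → Bool, 𝔼 u : Fin m → Bool,
        ∑ x : Fin k → Fin m → Bool, playersWeight (update (mask (fun i => !D i) u) j true) x *
          (err (hardInput φ p₀ (update (mask (fun i => !D i) u) j true)
              (update x i (update (mask D u) j false))) +
            err (hardInput φ p₀ (update (mask (fun i => !D i) u) j true)
              (update x i (update (mask D u) j true))))) - 4 * m ≤
      24 * l * ((k - 1) * -Real.log (1 - η) +
        2 * T * (-Real.log (η / 2) + 2 * Real.log 4 + 2 * Real.log k)) +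
      (k - 1) * (2 * m / l) := by
  classical
  have hk : 0 < k := p₀.pos
  have hcard : ((univ.erase p₀).card : ℝ) = k - 1 := by
    rw [Finset.card_erase_of_mem (mem_univ _), Finset.card_univ, Fintype.card_fin,
      Nat.cast_sub hk, Nat.cast_one]
  have hout : ∀ S ∈ D₀, P.answer S T ≠ distinctCount S → 1 ≤ err S := by
    intro S hS hne
    refine herr S fun h => hne ?_
    exact P.answer_eq_of_outputs (P.speaker_run_eq_none_of_cost_le (hcost S hS)) h
  have hlocal : ∀ i ≠ p₀, ∀ (j : Fin m) (D u : Fin m → Bool),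
      1 - (∑ x : Fin k → Fin m → Bool,
        playersWeight (update (mask (fun i => !D i) u) j true) x *
          (err (hardInput φ p₀ (update (mask (fun i => !D i) u) j true)
              (update x i (update (mask D u) j false))) +
            err (hardInput φ p₀ (update (mask (fun i => !D i) u) j true)
              (update x i (update (mask D u) j true))))) -
        reporterProb P T φ p₀ i (update (mask D u) j false)
          (update (mask (fun i => !D i) u) j true) ≤
      acceptProb P T (m + r) φ p₀ i (update (mask D u) j false)
          (update (mask (fun i => !D i) u) j true) -
        acceptProb P T (m + r) φ p₀ i (update (mask D u) j true)
          (update (mask (fun i => !D i) u) j true) := by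
    intro i hi j D u
    unfold reporterProb acceptProb
    refine le_trans (sub_le_sub_right (sub_le_sub_right
      (sum_playersWeight (k := k) (update (mask (fun i => !D i) u) j true)).ge _) _) ?_
    rw [← Finset.sum_sub_distrib, ← Finset.sum_sub_distrib, ← Finset.sum_sub_distrib]
    refine Finset.sum_le_sum fun x _ => ?_
    by_cases hW : playersWeight (update (mask (fun i => !D i) u) j true) x = 0
    · simp [hW]
    have e0 := distinctCount_planted_false φ p₀ i j D u hW
    have e1 := distinctCount_planted_true φ hi j D u hW
    set S₀ := hardInput φ p₀ (update (mask (fun i => !D i) u) j true)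
      (update x i (update (mask D u) j false))
    set S₁ := hardInput φ p₀ (update (mask (fun i => !D i) u) j true)
      (update x i (update (mask D u) j true))
    have a0 := hout S₀ (hD₀ _ e0)
    have a1 := hout S₁ (hD₁ _ e1)
    rw [e0] at a0
    rw [e1] at a1
    have n0 := herr0 S₀
    have n1 := herr0 S₁
    have key : 1 - (err S₀ + err S₁) - (if P.reporter (P.run S₀ T) = i then 1 else 0) ≤
        (if P.reporter (P.run S₀ T) ≠ i ∧ P.answer S₀ T = m + r then 1 else 0) -
          (if P.reporter (P.run S₁ T) ≠ i ∧ P.answer S₁ T = m + r then (1 : ℝ) else 0) := by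
      have b1 : (if P.reporter (P.run S₁ T) ≠ i ∧ P.answer S₁ T = m + r then (1 : ℝ) else 0) ≤
          err S₁ := by
        split_ifs with h
        · exact a1 (by omega)
        · exact n1
      have b0 : 1 - err S₀ - (if P.reporter (P.run S₀ T) = i then 1 else 0) ≤
          (if P.reporter (P.run S₀ T) ≠ i ∧ P.answer S₀ T = m + r then (1 : ℝ) else 0) := by
        by_cases h : P.reporter (P.run S₀ T) = i
        · simp [h, n0]
        · by_cases h' : P.answer S₀ T = m + r
          · simp [h, h', n0]
          · simpa [h, h'] using a0 h'
      linarith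
    have := mul_le_mul_of_nonneg_left key
      (playersWeight_nonneg (update (mask (fun i => !D i) u) j true) x)
    linarith
  have hup := Finset.sum_le_sum fun i (hi : i ∈ univ.erase p₀) =>
    sum_acceptProb_sub_le P T (m + r) φ (Finset.ne_of_mem_erase hi) h0 h1 hl
  have hlow := Finset.sum_le_sum fun i (hi : i ∈ univ.erase p₀) =>
    Finset.sum_le_sum fun j (_ : j ∈ univ) =>
      Finset.expect_le_expect fun D (_ : D ∈ univ) => Finset.expect_le_expect
        fun u (_ : u ∈ univ) => hlocal i (Finset.ne_of_mem_erase hi) j D u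
  have hrep := sum_reporterProb_le P T φ p₀ (univ.erase p₀)
  simp only [Finset.expect_sub_distrib, Finset.sum_sub_distrib, Fintype.expect_const,
    Finset.sum_const, Finset.card_univ, Fintype.card_fin, nsmul_eq_mul, mul_one, hcard] at hlow
  simp only [Finset.expect_sub_distrib, Finset.sum_sub_distrib] at hup
  rw [Finset.sum_add_distrib, Finset.sum_const, nsmul_eq_mul, hcard, ← Finset.mul_sum,
    Finset.sum_add_distrib, Finset.sum_const, nsmul_eq_mul, hcard, ← Finset.sum_mul,
    sum_disjointMean] at hup
  have hbits : disjointMean k m (fun y x => ∑ i ∈ univ.erase p₀,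
      (((P.run (hardInput φ p₀ y x) T).view i).bits : ℝ)) ≤ 2 * T := by
    rw [← disjointMean_const (k := k) (m := m) (2 * T : ℝ)]
    refine disjointMean_mono fun y x hW => ?_
    have hS := hcost _ (hD₀ _ (distinctCount_hardInput_of_disjoint φ p₀ (y := y) (x := x)
      fun p j hy => eq_false_of_playersWeight_ne_zero hW p hy))
    have c1 := P.bits_run_le_of_cost_le hS T
    have c2 := (P.run (hardInput φ p₀ y x) T).sum_bits_view_le
    have c3 : ∑ i ∈ univ.erase p₀, ((P.run (hardInput φ p₀ y x) T).view i).bits ≤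
        ∑ i, ((P.run (hardInput φ p₀ y x) T).view i).bits :=
      Finset.sum_le_sum_of_subset (Finset.erase_subset _ _)
    have c4 : ∑ i ∈ univ.erase p₀, ((P.run (hardInput φ p₀ y x) T).view i).bits ≤ 2 * T := by
      omega
    exact_mod_cast c4
  have hB : 0 ≤ -Real.log (η / 2) + 2 * Real.log 4 + 2 * Real.log k := by
    have a1 : Real.log (η / 2) ≤ 0 := Real.log_nonpos (by linarith) (by linarith)
    have a2 : 0 ≤ Real.log 4 := Real.log_nonneg (by norm_num)
    have a3 : 0 ≤ Real.log k := Real.log_nonneg (by exact_mod_cast hk)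
    linarith
  have hfin := mul_le_mul_of_nonneg_left (mul_le_mul_of_nonneg_right hbits hB)
    (show 0 ≤ 24 * l by positivity)
  linarith

/-- For `49 ≤ k` the players have to communicate `Ω(k F / log k)` bits. -/
theorem mul_le_cost_mul_log {F : ℕ} (hk : 49 ≤ k) (hF : 2 ≤ F) (hFn : F ≤ n)
    (Q : RandomizedProtocol k (Finset (Fin n)) ℕ)
    (hQ : Q.Computes (inputsOfOrder k n F) distinctCount (1 / 3)) {T : ℕ}
    (hT : Q.cost (inputsOfOrder k n F) ≤ T) : (k * F : ℝ) ≤ 500000 * T * Real.log k := by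
  let _ := Q.measurableSpace
  have _ := Q.isProbabilityMeasure
  obtain ⟨m, r, hm, hmr, hr⟩ : ∃ m r : ℕ, 1 ≤ m ∧ 2 * m + r = F ∧ r ≤ 1 :=
    ⟨F / 2, F % 2, by omega, by omega, by omega⟩
  obtain ⟨φ⟩ : Nonempty ((Fin m × Bool) ⊕ Fin r ↪ Fin n) := by
    refine Function.Embedding.nonempty_of_card_le ?_
    simp
    omega
  let p₀ : Fin k := ⟨0, by omega⟩
  have hD₀ : ∀ S : Fin k → Finset (Fin n), distinctCount S = m + r → S ∈ inputsOfOrder k n F := by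
    intro S hS
    simp only [inputsOfOrder, Set.mem_ofPred_eq, hS]
    omega
  have hD₁ : ∀ S : Fin k → Finset (Fin n), distinctCount S = m + r + 1 →
      S ∈ inputsOfOrder k n F := by
    intro S hS
    simp only [inputsOfOrder, Set.mem_ofPred_eq, hS]
    omega
  let err : (Fin k → Finset (Fin n)) → Q.Tapes → ℝ := fun S =>
    (MeasureTheory.toMeasurable Q.law
      {ω | ¬ (Q.protocol ω).Outputs S (distinctCount S)}).indicator fun _ => 1
  have herr : ∀ S ∈ inputsOfOrder k n F, MeanLE Q.law (err S) (1 / 3) := by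
    intro S hS
    refine MeanLE.indicator_toMeasurable (by norm_num) ((hQ S hS).trans (le_of_eq ?_))
    rw [ENNReal.ofReal_div_of_pos (by norm_num)]
    simp
  -- the mean over the tapes of the number of errors, weighted by the planted inputs
  have hmean : MeanLE Q.law (fun ω => ∑ i ∈ univ.erase p₀, ∑ j, 𝔼 D : Fin m → Bool,
      𝔼 u : Fin m → Bool, ∑ x : Fin k → Fin m → Bool,
        playersWeight (update (mask (fun i => !D i) u) j true) x *
          (err (hardInput φ p₀ (update (mask (fun i => !D i) u) j true)
              (update x i (update (mask D u) j false))) ω +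
            err (hardInput φ p₀ (update (mask (fun i => !D i) u) j true)
              (update x i (update (mask D u) j true))) ω))
      (∑ i ∈ univ.erase p₀, ∑ _j : Fin m, 2 / 3) := by
    refine MeanLE.sum fun i hi => MeanLE.sum fun j _ => MeanLE.expect fun D => MeanLE.expect
      fun u => ?_
    have e : (2 / 3 : ℝ) = ∑ x : Fin k → Fin m → Bool,
        playersWeight (update (mask (fun i => !D i) u) j true) x * (1 / 3 + 1 / 3) := by
      rw [← Finset.sum_mul, sum_playersWeight]
      norm_num
    rw [e]
    refine MeanLE.sum fun x _ => MeanLE.const_mul (playersWeight_nonneg _ _) fun hW => ?_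
    exact MeanLE.add (herr _ (hD₀ _ (distinctCount_planted_false φ p₀ i j D u hW)))
      (herr _ (hD₁ _ (distinctCount_planted_true φ (Finset.ne_of_mem_erase hi) j D u hW)))
  obtain ⟨ω, hω⟩ := hmean.exists_le
  have hkR : (49 : ℝ) ≤ k := by exact_mod_cast hk
  have hcost : ∀ S ∈ inputsOfOrder k n F, (Q.protocol ω).cost S ≤ T := by
    intro S hS
    refine le_trans ?_ hT
    exact le_iSup₂_of_le S hS (le_iSup (fun ω => (Q.protocol ω).cost S) ω)
  have main := communication_ge_of_errors (Q.protocol ω) T φ p₀ _ hD₀ hD₁ hcost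
    (fun S => err S ω) (fun S => Set.indicator_nonneg (fun _ _ => zero_le_one) _)
    (fun S hS => by
      have : ω ∈ MeasureTheory.toMeasurable Q.law
          {ω | ¬ (Q.protocol ω).Outputs S (distinctCount S)} :=
        MeasureTheory.subset_toMeasurable _ _ hS
      simp only [err, Set.indicator_of_mem this, le_refl])
    -- `l = 12` leaves `1 / 3 - 2 / l = 1 / 6` of the success probability, half of which covers the
    -- reports by player `i` itself; `η` makes `24 * l * -log (1 - η)` smaller than `1 / 24`
    (η := 1 / 10000) (by norm_num) (by norm_num) (l := 12) (by norm_num)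
  have hcard : ((univ.erase p₀).card : ℝ) = k - 1 := by
    rw [Finset.card_erase_of_mem (mem_univ _), Finset.card_univ, Fintype.card_fin,
      Nat.cast_sub (by omega), Nat.cast_one]
  rw [Finset.sum_const, Finset.sum_const, nsmul_eq_mul, nsmul_eq_mul, hcard, Finset.card_univ,
    Fintype.card_fin] at hω
  have hε : -Real.log (1 - 1 / 10000) ≤ 1 / 9999 := by
    have := Real.one_sub_inv_le_log_of_pos (show (0 : ℝ) < 1 - 1 / 10000 by norm_num)
    norm_num at this ⊢
    linarith
  have hB : -Real.log (1 / 10000 / 2) + 2 * Real.log 4 ≤ 4 * Real.log k := by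
    have a1 : -Real.log (1 / 10000 / 2) + 2 * Real.log 4 = Real.log 320000 := by
      have b1 : (320000 : ℝ) = 20000 * 4 ^ 2 := by norm_num
      have b2 : (1 / 10000 / 2 : ℝ) = (20000 : ℝ)⁻¹ := by norm_num
      rw [b1, b2, Real.log_inv, Real.log_mul (by norm_num) (by norm_num), Real.log_pow]
      push_cast
      ring
    have a2 : Real.log ((k : ℝ) ^ 4) = 4 * Real.log k := by
      rw [Real.log_pow]
      norm_num
    rw [a1, ← a2]
    refine Real.log_le_log (by norm_num) ?_
    calc (320000 : ℝ) ≤ 49 ^ 4 := by norm_num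
      _ ≤ (k : ℝ) ^ 4 := by gcongr
  have hmR : (1 : ℝ) ≤ m := by exact_mod_cast hm
  have hFR : (F : ℝ) ≤ 3 * m := by
    have : F ≤ 3 * m := by omega
    exact_mod_cast this
  have hT0 : (0 : ℝ) ≤ T := Nat.cast_nonneg _
  have hLε : ((k : ℝ) - 1) * -Real.log (1 - 1 / 10000) ≤ (k - 1) * (1 / 9999) :=
    mul_le_mul_of_nonneg_left hε (by linarith)
  have hTB : 2 * (T : ℝ) * (-Real.log (1 / 10000 / 2) + 2 * Real.log 4 + 2 * Real.log k) ≤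
      2 * T * (6 * Real.log k) :=
    mul_le_mul_of_nonneg_left (by linarith) (by positivity)
  have hkm : (48 : ℝ) * m ≤ (k - 1) * m :=
    mul_le_mul_of_nonneg_right (by linarith) (by linarith)
  have hkm' : ((k : ℝ) - 1) * 1 ≤ (k - 1) * m :=
    mul_le_mul_of_nonneg_left hmR (by linarith)
  have hkF : (k : ℝ) * F ≤ (49 / 48 * (k - 1)) * (3 * m) :=
    mul_le_mul (by linarith) hFR (Nat.cast_nonneg _) (by linarith)
  have hlk : 0 ≤ T * Real.log k := mul_nonneg hT0 (Real.log_nonneg (by linarith))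
  linarith

end LowerBound

end MessagePassing

theorem mainTheorem3 :
    ∃ c : ℝ, 0 < c ∧ ∃ C : ℝ, 0 < C ∧
      ∀ k n : ℕ, 2 ≤ k → C * Real.logb 2 n ≤ k → k ≤ n →
        (ENNReal.ofReal (c * (k * n) / Real.logb 2 k) ≤
          (MessagePassing.randomizedComplexity (1 / 3) Set.univ
            (MessagePassing.distinctCount (k := k) (n := n)) : ℝ≥0∞)) ∧
        ∀ F : ℕ, 2 ≤ F → F ≤ n →
          ENNReal.ofReal (c * (k * F) / Real.logb 2 k) ≤
            (MessagePassing.randomizedComplexity (1 / 3) (MessagePassing.inputsOfOrder k n F)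
              (MessagePassing.distinctCount (k := k) (n := n)) : ℝ≥0∞) := by
  refine ⟨1 / 500000, by norm_num, 49, by norm_num, fun k n hk hkn hkn' => ?_⟩
  have hk49 : 49 ≤ k := by
    have h1 : 1 ≤ Real.logb 2 n := by
      rw [Real.le_logb_iff_rpow_le (by norm_num) (by exact_mod_cast by omega), Real.rpow_one]
      exact_mod_cast hk.trans hkn'
    have h2 : (49 : ℝ) ≤ k := by linarith
    exact_mod_cast h2
  have hlog : 0 < Real.log k := Real.log_pos (by exact_mod_cast by omega)
  have hF : ∀ F : ℕ, 2 ≤ F → F ≤ n →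
      ENNReal.ofReal (1 / 500000 * (k * F) / Real.logb 2 k) ≤
        (MessagePassing.randomizedComplexity (1 / 3) (MessagePassing.inputsOfOrder k n F)
          (MessagePassing.distinctCount (k := k) (n := n)) : ℝ≥0∞) := by
    intro F hF2 hFn
    -- costs are natural numbers or infinite, so the bound may be rounded up
    set b : ℝ := 1 / 500000 * (k * F) / Real.logb 2 k with hb
    have h1 : ((⌈b⌉₊ : ℕ) : ℕ∞) ≤ MessagePassing.randomizedComplexity (1 / 3)
        (MessagePassing.inputsOfOrder k n F)
        (MessagePassing.distinctCount (k := k) (n := n)) := by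
      refine le_iInf₂ fun Q hQ => ?_
      cases hT : Q.cost (MessagePassing.inputsOfOrder k n F) with
      | top => exact le_top
      | coe T =>
        have h2 := MessagePassing.mul_le_cost_mul_log hk49 hF2 hFn Q hQ hT.le
        have h3 : b ≤ T := by
          rw [hb, Real.logb, div_div_eq_mul_div, div_le_iff₀ hlog]
          have h4 : Real.log 2 ≤ 1 := by linarith [Real.log_two_lt_d9]
          have h5 : 0 ≤ 1 / 500000 * ((k : ℝ) * F) := by positivity
          calc 1 / 500000 * ((k : ℝ) * F) * Real.log 2 ≤ 1 / 500000 * ((k : ℝ) * F) * 1 :=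
                mul_le_mul_of_nonneg_left h4 h5
            _ ≤ T * Real.log k := by linarith
        exact_mod_cast Nat.ceil_le.2 h3
    calc ENNReal.ofReal b ≤ ENNReal.ofReal (⌈b⌉₊ : ℝ) := ENNReal.ofReal_le_ofReal (Nat.le_ceil b)
      _ = (((⌈b⌉₊ : ℕ) : ℕ∞) : ℝ≥0∞) := by simp
      _ ≤ _ := ENat.toENNReal_le.2 h1
  refine ⟨(hF n (hk.trans hkn') le_rfl).trans (ENat.toENNReal_le.2 ?_), hF⟩
  -- a protocol for all inputs is in particular one for the promise problem
  refine le_iInf₂ fun Q hQ => ?_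
  refine (iInf₂_le Q fun x _ => hQ x (Set.mem_univ x)).trans ?_
  exact biSup_mono fun x _ => Set.mem_univ x
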